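/- Let $m$ be Lebesgue measure on $I=[0,1]$, and let $\varphi:[0,1]\to\mathbb R$ be increasing (in the wide sense) and concave with $\varphi(0)=0$, $\varphi(1)>0$ and $\lim_{t\to0+}\varphi(t)=0$. For a measurable real function $x$ on a finite measure space $(\Omega,\nu)$ let $x^*(t)=\inf\{s\ge 0:\nu\{|x|>s\}\le t\}$. The Lorentz space $\Lambda_\varphi$ consists of all measurable $x$ on $I$ (identified a.e.) with $\|x\|_{\Lambda_\varphi}=\int_0^1x^*(t)\,d\varphi(t)<\infty$, and $\Lambda_\varphi(I\times I)$ is defined in the same way on the square $I\times I$ with two-dimensional Lebesgue measure. The multiplicator space $\mathscr M(\Lambda_\varphi)$ is the set of all measurable $f$ on $I$ such that $y\mapsto f\otimes y$, $(f\otimes y)(s,t)=f(s)y(t)$, is a bounded operator from $\Lambda_\varphi$ into $\Lambda_\varphi(I\times I)$. Put $V_0f(t)=f(2t)$ for $0\le t\le\frac12$ and $V_0f(t)=0$ otherwise, $V_1f(t)=f(2t-1)$ for $\frac12\le t\le1$ and $V_1f(t)=0$ otherwise, and $V^\alpha f=V_{\alpha_1}\cdots V_{\alpha_k}f$ for a multi-index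 $\alpha=(\alpha_1,\dots,\alpha_k)\in\{0,1\}^k$, $|\alpha|=k\ge 0$. The system $\{V^\alpha f\}$ of dyadic dilations and translations of $f$ is called an absolutely representing system in $\Lambda_\varphi$ if there is a constant $C>0$ such that for every $x\in\Lambda_\varphi$ there are real coefficients $\xi_\alpha$ with $$x=\sum_\alpha\xi_\alpha V^\alpha f\ \text{ (unconditional convergence in the norm of }\Lambda_\varphi),\qquad \sum_{k=0}^\infty\Bigl\|\sum_{|\alpha|=k}\xi_\alpha V^\alpha f\Bigr\|_{\Lambda_\varphi}\le C\|x\|_{\Lambda_\varphi}.$$ **Theorem.** Let $0\ne f\in\Lambda_\varphi$ with $f=f^*$ a.e. (that is, $f$ is nonnegative and decreasing). Then $\{V^\alpha f\}$ is an absolutely representing system in $\Lambda_\varphi$ if and only if $f\in\mathscr M(\Lambda_\varphi)$. -/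

import Mathlib

open Set Filter Topology MeasureTheory
open scoped ENNReal NNReal

noncomputable section

namespace LorentzDyadic

/-- Lebesgue measure `m` on the interval `I = [0, 1]`. Functions on `[0, 1]` are represented by
functions on `ℝ`, of which only the restriction to `[0, 1]` (up to null sets) matters. -/
def leb : Measure ℝ := volume.restrict (Icc 0 1)

/-- Decreasing right-continuous rearrangement of (the absolute value of) a function on a measure
space: `x^*(t) = inf {s ≥ 0 : ν {|x| > s} ≤ t}`, with values in `[0, ∞]`. -/
def rearrangement {Ω : Type*} [MeasurableSpace Ω] (ν : Measure Ω) (x : Ω → ℝ) (t : ℝ) : ℝ≥0∞ :=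
  sInf {s : ℝ≥0∞ | ν {u | s < ‖x u‖ₑ} ≤ ENNReal.ofReal t}

/-- The extension of `φ : [0, 1] → ℝ` to `ℝ` by the constants `φ 0` and `φ 1`. -/
def extendConst (φ : ℝ → ℝ) (t : ℝ) : ℝ := φ (max 0 (min 1 t))

theorem extendConst_monotone {φ : ℝ → ℝ} (hφ : MonotoneOn φ (Icc 0 1)) : Monotone (extendConst φ) := by
  intro s t hst
  refine hφ ?_ ?_ (max_le_max le_rfl (min_le_min le_rfl hst))
  · exact ⟨le_max_left _ _, max_le zero_le_one (min_le_left _ _)⟩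
  · exact ⟨le_max_left _ _, max_le zero_le_one (min_le_left _ _)⟩

/-- The Lebesgue-Stieltjes measure `dφ` on `[0, 1]` of an increasing function `φ` on `[0, 1]`. -/
def stieltjes (φ : ℝ → ℝ) (hφ : MonotoneOn φ (Icc 0 1)) : Measure ℝ :=
  ((extendConst_monotone hφ).stieltjesFunction.measure).restrict (Icc 0 1)

section Lorentz

variable {Ω : Type*} [MeasurableSpace Ω] (φ : ℝ → ℝ) (hφ : MonotoneOn φ (Icc 0 1))

/-- The Lorentz norm `∫_0^1 x^*(t) dφ(t)`, with values in `[0, ∞]`, where `x^*` is the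
rearrangement with respect to `ν`. -/
def lorentzNorm (ν : Measure Ω) (x : Ω → ℝ) : ℝ≥0∞ :=
  ∫⁻ t, rearrangement ν x t ∂(stieltjes φ hφ)

/-- Membership in the Lorentz space: `x` is measurable and has finite Lorentz norm. For `ν = leb`
this is the space `Λ_φ` on `I`, for `ν = leb.prod leb` the space `Λ_φ(I × I)`. -/
def MemLorentz (ν : Measure Ω) (x : Ω → ℝ) : Prop :=
  AEStronglyMeasurable x ν ∧ lorentzNorm φ hφ ν x < ∞

end Lorentz

/-- The tensor product `(x ⊗ y)(s, t) = x(s) y(t)`. -/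
def tensor (x y : ℝ → ℝ) : ℝ × ℝ → ℝ := fun p => x p.1 * y p.2

/-- `f` belongs to the multiplicator space `𝓜(Λ_φ)`: the operator `y ↦ f ⊗ y` is bounded from
`Λ_φ` into `Λ_φ(I × I)`. -/
def MemMultiplicator (φ : ℝ → ℝ) (hφ : MonotoneOn φ (Icc 0 1)) (f : ℝ → ℝ) : Prop :=
  AEStronglyMeasurable f leb ∧
    ∃ C : ℝ≥0, ∀ y : ℝ → ℝ, MemLorentz φ hφ leb y →
      MemLorentz φ hφ (leb.prod leb) (tensor f y) ∧
        lorentzNorm φ hφ (leb.prod leb) (tensor f y) ≤ C * lorentzNorm φ hφ leb y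

open Classical in
/-- The operators `V₀` (for `false`) and `V₁` (for `true`):
`V₀ f(t) = f(2t)` on `[0, 1/2]`, `V₁ f(t) = f(2t - 1)` on `[1/2, 1]`, and zero elsewhere. -/
def V : Bool → (ℝ → ℝ) → ℝ → ℝ
  | false, f => fun t => if t ∈ Icc (0 : ℝ) (1 / 2) then f (2 * t) else 0
  | true, f => fun t => if t ∈ Icc (1 / 2 : ℝ) 1 then f (2 * t - 1) else 0

/-- For a multi-index `α = (α₁, …, α_k)` (a finite word in `0, 1`, of length `|α| = k`, possibly
empty), `V^α f = V_{α₁} ⋯ V_{α_k} f`. -/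
def Vpow (α : List Bool) (f : ℝ → ℝ) : ℝ → ℝ := α.foldr V f

/-- The dyadic dilations and translations `V^α f` form an absolutely representing system in `Λ_φ`
with the constant `C`: every `x ∈ Λ_φ` is the sum, in the norm of `Λ_φ`, of a series
`∑_α ξ_α V^α f` over all multi-indices, with `∑_k ‖∑_{|α| = k} ξ_α V^α f‖ ≤ C ‖x‖`. -/
def IsAbsRepresentingWith (φ : ℝ → ℝ) (hφ : MonotoneOn φ (Icc 0 1)) (f : ℝ → ℝ)
    (C : ℝ≥0) : Prop :=
  ∀ x : ℝ → ℝ, MemLorentz φ hφ leb x → ∃ ξ : List Bool → ℝ,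
    Tendsto (fun s : Finset (List Bool) =>
        lorentzNorm φ hφ leb (fun t => x t - ∑ α ∈ s, ξ α * Vpow α f t)) atTop (𝓝 0) ∧
    ∑' k : ℕ, lorentzNorm φ hφ leb
        (fun t => ∑ α : Fin k → Bool, ξ (List.ofFn α) * Vpow (List.ofFn α) f t)
      ≤ C * lorentzNorm φ hφ leb x

/-- The dyadic dilations and translations of `f` form an absolutely representing system. -/
def IsAbsRepresenting (φ : ℝ → ℝ) (hφ : MonotoneOn φ (Icc 0 1)) (f : ℝ → ℝ) : Prop :=
  ∃ C : ℝ≥0, 0 < C ∧ IsAbsRepresentingWith φ hφ f C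

end LorentzDyadic

end

/-! The starting point is the formula `‖x‖ = ∫₀^∞ φ(ν{|x| > s}) ds` (`lorentzNorm_eq_cakeNorm`),
together with the representation of `φ` as an integral of the functions `u ↦ min (u, a r)`, where
`a` is the distribution function of `φ'`. The facts needed about `φ` (Jensen, doubling, the triangle
inequality for the norm) then reduce to elementary facts about `min`.

Let `T` be the doubling map `dbl`. Almost everywhere, a combination of the `V^α f` with `|α| = k` is
`c(first k digits of t) · f(T^k t)`. The first `k` digits and `T^k t` are independent, so this
function is equimeasurable with `f ⊗ c` (`cakeNorm_levelFn`). This is how multiplicators enter.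

Sufficiency. If `f` is a multiplicator, a level with step coefficients `c` costs at most `M ‖c‖`.
Approximate `x` by a step function `e` and spread `e / ∫ f` evenly over `n` levels: the sum is `e`
times an ergodic average of `f` divided by `∫ f`. By the law of large numbers such averages tend to
`∫ f` in norm (`exists_average_cakeNorm_le`), so a finite block of levels halves the error at a cost
`≤ const · ‖x‖` (`exists_block`). Iterating gives a geometric series of costs. Of the monotonicity
of `f`, only `∫ f ≠ 0` matters here.

Necessity. Let `A` be the last dyadic interval of length `h = 2⁻ⁿ` and `ψ(h) = ‖f ⊗ 1_A‖`. Every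
level function `L` satisfies `ψ(h) ∫_A |L| ≤ ‖f‖₁ h ‖L‖` (`cakeNorm_mul_setLIntegral_levelFn_le`):
on fine levels by concavity of `φ`, on coarse levels because a decreasing `f` has its smallest
averages at the right end. Expanding `1_A` and summing over the levels gives `ψ(h) ≤ C ‖f‖₁ φ(h)`.
So `f ⊗ 1_A` is controlled for dyadic measures, then for all measurable sets by doubling, and then
`f ⊗ y` for all `y` by dyadic layers (`cakeNorm_tensor_le`). -/

noncomputable section

namespace LorentzDyadic

/-- The distribution function `s ↦ ν {|x| > s}`. -/
def distr {Ω : Type*} [MeasurableSpace Ω] (ν : Measure Ω) (x : Ω → ℝ) (s : ℝ) : ℝ≥0∞ :=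
  ν {u | ENNReal.ofReal s < ‖x u‖ₑ}

/-- The concave function `u ↦ ∫₀^∞ min (u, a r) dr` generated by the profile `a`. -/
def mixMin (a : ℝ → ℝ≥0∞) (u : ℝ≥0∞) : ℝ≥0∞ := ∫⁻ r in Ioi 0, min u (a r)

/-- The Lorentz norm in terms of the distribution function. -/
def cakeNorm {Ω : Type*} [MeasurableSpace Ω] (a : ℝ → ℝ≥0∞) (ν : Measure Ω) (x : Ω → ℝ) : ℝ≥0∞ :=
  ∫⁻ s in Ioi 0, mixMin a (distr ν x s)

/-- The right derivative of a concave function. -/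
def rderiv (φ : ℝ → ℝ) (u : ℝ) : ℝ := -derivWithin (-φ) (Ioi u) u

/-- The distribution function of the right derivative of `φ` on `(0, 1)`. -/
def slopeDistr (φ : ℝ → ℝ) (r : ℝ) : ℝ≥0∞ := volume {u | u ∈ Ioo (0 : ℝ) 1 ∧ r < rderiv φ u}

/-! ### The concave weight `φ` as a mixture of truncations -/

section Phi

variable {φ : ℝ → ℝ}

theorem slopeDistr_antitone : Antitone (slopeDistr φ) := fun _ _ h =>
  measure_mono fun _ hu => ⟨hu.1, h.trans_lt hu.2⟩

theorem le_of_concave (hconc : ConcaveOn ℝ (Icc 0 1) φ) (hzero : φ 0 = 0) {t : ℝ}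
    (ht : t ∈ Icc (0 : ℝ) 1) : t * φ 1 ≤ φ t := by
  have := hconc.2 (x := 0) (y := 1) (by simp) (by simp) (sub_nonneg.2 ht.2) ht.1 (by ring)
  simpa [hzero] using this

/-- Concavity leaves only the endpoints. At `0` the limit hypothesis applies; at `1` the function is
squeezed between `t φ(1)` and `φ(1)`. Hence `dφ` has no atoms. -/
theorem continuousOn_of_concave (hmono : MonotoneOn φ (Icc 0 1)) (hconc : ConcaveOn ℝ (Icc 0 1) φ)
    (hzero : φ 0 = 0) (hlim : Tendsto φ (𝓝[>] 0) (𝓝 0)) : ContinuousOn φ (Icc 0 1) := by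
  refine hconc.continuousOn_Icc zero_lt_one ?_ ?_
  · rw [← continuousWithinAt_Ioi_iff_Ici]
    simpa [ContinuousWithinAt, hzero] using hlim
  · rw [← continuousWithinAt_Iio_iff_Iic]
    have h1 : Tendsto (fun t : ℝ => t * φ 1) (𝓝[<] 1) (𝓝 (φ 1)) := by
      have : Continuous (fun t : ℝ => t * φ 1) := by fun_prop
      have h := this.tendsto 1
      rw [one_mul] at h
      exact h.mono_left nhdsWithin_le_nhds
    have hev : ∀ᶠ t : ℝ in 𝓝[<] 1, t ∈ Icc (0 : ℝ) 1 := by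
      filter_upwards [Ioo_mem_nhdsLT (zero_lt_one' ℝ)] with t ht using ⟨ht.1.le, ht.2.le⟩
    refine tendsto_of_tendsto_of_tendsto_of_le_of_le' h1 tendsto_const_nhds ?_ ?_
    · filter_upwards [hev] with t ht using le_of_concave hconc hzero ht
    · filter_upwards [hev] with t ht using hmono ht (by simp) ht.2

theorem continuous_extendConst (h : ContinuousOn φ (Icc 0 1)) : Continuous (extendConst φ) := by
  refine h.comp_continuous (by fun_prop) fun t => ⟨le_max_left _ _, ?_⟩
  exact max_le zero_le_one (min_le_left _ _)

theorem extendConst_eq {t : ℝ} (ht : t ∈ Icc (0 : ℝ) 1) : extendConst φ t = φ t := by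
  simp [extendConst, ht.1, ht.2]

theorem stieltjes_inter_Iio (hmono : MonotoneOn φ (Icc 0 1)) (h : ContinuousOn φ (Icc 0 1))
    (hzero : φ 0 = 0) {d : ℝ} (hd : d ∈ Icc (0 : ℝ) 1) :
    stieltjes φ hmono (Iio d) = ENNReal.ofReal (φ d) := by
  have hc := continuous_extendConst h
  have he : ∀ t, (extendConst_monotone hmono).stieltjesFunction t = extendConst φ t := fun t => by
    rw [Monotone.stieltjesFunction_eq]
    exact hc.continuousWithinAt.rightLim_eq
  have he' : ⇑(extendConst_monotone hmono).stieltjesFunction = extendConst φ := funext he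
  rw [stieltjes, Measure.restrict_apply measurableSet_Iio]
  have : Iio d ∩ Icc 0 1 = Ico 0 d := by
    ext t; simp only [mem_inter_iff, mem_Iio, mem_Icc, mem_Ico]
    exact ⟨fun h => ⟨h.2.1, h.1⟩, fun h => ⟨h.2, h.1, h.2.le.trans hd.2⟩⟩
  rw [this, StieltjesFunction.measure_Ico, he', hc.continuousWithinAt.leftLim_eq,
    hc.continuousWithinAt.leftLim_eq, extendConst_eq hd, extendConst_eq (by simp), hzero, sub_zero]

theorem rderiv_hasDeriv (hconc : ConcaveOn ℝ (Icc 0 1) φ) {u : ℝ} (hu : u ∈ Ioo (0 : ℝ) 1) :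
    HasDerivWithinAt φ (rderiv φ u) (Ioi u) u := by
  have := (hconc.neg.hasDerivWithinAt_rightDeriv_of_mem_interior (x := u) (by simpa using hu)).neg
  simpa [rderiv] using this

theorem rderiv_antitoneOn (hconc : ConcaveOn ℝ (Icc 0 1) φ) :
    AntitoneOn (rderiv φ) (Ioo 0 1) := by
  have := hconc.neg.monotoneOn_rightDeriv
  rw [interior_Icc] at this
  exact this.neg

theorem rderiv_nonneg (hmono : MonotoneOn φ (Icc 0 1)) (hconc : ConcaveOn ℝ (Icc 0 1) φ) {u : ℝ}
    (hu : u ∈ Ioo (0 : ℝ) 1) : 0 ≤ rderiv φ u := by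
  have h1 : (1 : ℝ) ∈ Icc (0 : ℝ) 1 := by simp
  have h2 := hconc.slope_le_of_hasDerivWithinAt_Ioi (Ioo_subset_Icc_self hu) h1 hu.2
    (rderiv_hasDeriv hconc hu)
  refine le_trans ?_ h2
  rw [slope_def_field]
  exact div_nonneg (sub_nonneg.2 (hmono (Ioo_subset_Icc_self hu) h1 hu.2.le)) (sub_nonneg.2 hu.2.le)

/-- A superlevel set of a decreasing function is an initial segment of `(0, 1)`, so it either
contains `(0, d)` or is contained in it. -/
theorem volume_superlevel_inter {g : ℝ → ℝ} (hg : AntitoneOn g (Ioo 0 1)) {d : ℝ}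
    (hd : d ∈ Icc (0 : ℝ) 1) (r : ℝ) :
    volume ({u | r < g u} ∩ Ioo 0 d) =
      min (ENNReal.ofReal d) (volume {u | u ∈ Ioo (0 : ℝ) 1 ∧ r < g u}) := by
  have hvol : volume (Ioo 0 d) = ENNReal.ofReal d := by simp
  by_cases h : ∀ u ∈ Ioo 0 d, r < g u
  · have h1 : {u | r < g u} ∩ Ioo 0 d = Ioo 0 d := inter_eq_right.2 h
    rw [h1, hvol, min_eq_left]
    rw [← hvol]
    exact measure_mono fun u hu => ⟨⟨hu.1, hu.2.trans_le hd.2⟩, h u hu⟩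
  · push Not at h
    obtain ⟨v, hv, hvr⟩ := h
    have h1 : {u | r < g u} ∩ Ioo 0 d = {u | u ∈ Ioo (0 : ℝ) 1 ∧ r < g u} := by
      ext u
      simp only [mem_inter_iff, mem_ofPred_eq]
      constructor
      · exact fun h => ⟨⟨h.2.1, h.2.2.trans_le hd.2⟩, h.1⟩
      · rintro ⟨h, h'⟩
        refine ⟨h', h.1, lt_of_not_ge fun hdu => ?_⟩
        have := hg ⟨hv.1, hv.2.trans_le hd.2⟩ h (hv.2.le.trans hdu)
        linarith
    rw [h1, min_eq_right]
    rw [← h1, ← hvol]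
    exact measure_mono inter_subset_right

/-- `φ(d)` is the integral of its right derivative over `(0, d)`. The layer cake formula for that
integral has layers of measure `min (d, a r)`. -/
theorem ofReal_eq_mixMin (hmono : MonotoneOn φ (Icc 0 1)) (hconc : ConcaveOn ℝ (Icc 0 1) φ)
    (h : ContinuousOn φ (Icc 0 1)) (hzero : φ 0 = 0) {d : ℝ} (hd : d ∈ Icc (0 : ℝ) 1) :
    ENNReal.ofReal (φ d) = mixMin (slopeDistr φ) (ENNReal.ofReal d) := by
  have hsub : Icc 0 d ⊆ Icc (0 : ℝ) 1 := Icc_subset_Icc le_rfl hd.2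
  have hsub' : Ioo 0 d ⊆ Ioo (0 : ℝ) 1 := Ioo_subset_Ioo le_rfl hd.2
  have hder : ∀ u ∈ Ioo 0 d, HasDerivWithinAt φ (rderiv φ u) (Ioi u) u := fun u hu =>
    rderiv_hasDeriv hconc (hsub' hu)
  have hpos : ∀ u ∈ Ioo 0 d, 0 ≤ rderiv φ u := fun u hu => rderiv_nonneg hmono hconc (hsub' hu)
  have hint : IntegrableOn (rderiv φ) (Ioc 0 d) :=
    intervalIntegral.integrableOn_deriv_right_of_nonneg (h.mono hsub) hder hpos
  have hftc := intervalIntegral.integral_eq_sub_of_hasDeriv_right_of_le hd.1 (h.mono hsub) hder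
    ((intervalIntegrable_iff_integrableOn_Ioc_of_le hd.1).2 hint)
  rw [hzero, sub_zero, intervalIntegral.integral_of_le hd.1, integral_Ioc_eq_integral_Ioo] at hftc
  have hint' : IntegrableOn (rderiv φ) (Ioo 0 d) := hint.mono_set Ioo_subset_Ioc_self
  have hpos' : 0 ≤ᵐ[volume.restrict (Ioo 0 d)] rderiv φ :=
    (ae_restrict_iff' measurableSet_Ioo).2 (Eventually.of_forall hpos)
  rw [← hftc, ofReal_integral_eq_lintegral_ofReal hint' hpos',
    lintegral_eq_lintegral_meas_lt _ hpos' hint'.aemeasurable, mixMin]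
  refine lintegral_congr fun r => ?_
  rw [Measure.restrict_apply₀' measurableSet_Ioo.nullMeasurableSet,
    volume_superlevel_inter (rderiv_antitoneOn hconc) hd]
  rfl

end Phi

/-! ### Rearrangements and the distributional formula for the norm -/

section Rearrangement

variable {Ω : Type*} [MeasurableSpace Ω] {ν : Measure Ω} {x : Ω → ℝ}

theorem distr_antitone : Antitone (distr ν x) := fun _ _ h =>
  measure_mono fun _ hu => (ENNReal.ofReal_le_ofReal h).trans_lt hu

theorem rearrangement_antitone : Antitone (rearrangement ν x) := fun _ _ h =>
  sInf_le_sInf fun _ hs => le_trans (mem_ofPred.1 hs) (ENNReal.ofReal_le_ofReal h)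

/-- The rearrangement is the generalized inverse of the distribution function. For the converse
implication, `{|x| > s}` is the increasing union of `{|x| > v n}` with `v n ↓ s`, so some level
strictly above `s` still has measure greater than `t`. -/
theorem ofReal_lt_rearrangement_iff {s t : ℝ} :
    ENNReal.ofReal s < rearrangement ν x t ↔ ENNReal.ofReal t < distr ν x s := by
  constructor
  · intro h
    by_contra! hle
    exact absurd h (not_lt.2 (sInf_le hle))
  · intro h
    obtain ⟨v, hv, hvpos, hvlim⟩ := exists_seq_strictAnti_tendsto' (ENNReal.ofReal_lt_top (r := s))
    have hU : {u | ENNReal.ofReal s < ‖x u‖ₑ} = ⋃ n, {u | v n < ‖x u‖ₑ} := by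
      ext u
      simp only [mem_ofPred_eq, mem_iUnion]
      constructor
      · intro hu
        exact ((tendsto_order.1 hvlim).2 _ hu).exists
      · rintro ⟨n, hn⟩
        exact (hvpos n).1.trans hn
    have hmon : Monotone fun n => {u | v n < ‖x u‖ₑ} := fun m n hmn u hu =>
      (hv.antitone hmn).trans_lt hu
    rw [distr, hU, hmon.measure_iUnion, lt_iSup_iff] at h
    obtain ⟨n, hn⟩ := h
    refine (hvpos n).1.trans_le (le_sInf fun s' hs' => le_of_not_gt fun hlt => ?_)
    refine absurd (mem_ofPred.1 hs') (not_le.2 (hn.trans_le (measure_mono fun u hu => ?_)))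
    exact hlt.trans hu

theorem lintegral_indicator_ofReal_lt (c : ℝ≥0∞) :
    ∫⁻ s in Ioi (0 : ℝ), {s : ℝ | ENNReal.ofReal s < c}.indicator 1 s = c := by
  have hm : MeasurableSet {s : ℝ | ENNReal.ofReal s < c} :=
    measurableSet_lt ENNReal.measurable_ofReal measurable_const
  rw [lintegral_indicator_one hm, Measure.restrict_apply hm]
  induction c with
  | top =>
    have : {s : ℝ | ENNReal.ofReal s < ⊤} ∩ Ioi 0 = Ioi 0 := by ext; simp
    rw [this]; simp
  | coe c =>
    have : {s : ℝ | ENNReal.ofReal s < c} ∩ Ioi 0 = Ioo 0 (c : ℝ) := by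
      ext s
      simp only [mem_inter_iff, mem_ofPred_eq, mem_Ioi, mem_Ioo]
      constructor
      · rintro ⟨h, h'⟩
        refine ⟨h', ?_⟩
        rw [← ENNReal.ofReal_coe_nnreal] at h
        exact (ENNReal.ofReal_lt_ofReal_iff_of_nonneg h'.le).1 h
      · rintro ⟨h, h'⟩
        refine ⟨?_, h⟩
        rw [← ENNReal.ofReal_coe_nnreal]
        exact (ENNReal.ofReal_lt_ofReal_iff_of_nonneg h.le).2 h'
    rw [this]; simp

/-- Write `x^*(t)` as the length of `{s > 0 : s < x^*(t)}` and exchange the integrals. By the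
inverse relation, for fixed `s` the set of `t` in `[0, 1]` is an initial interval of length `ν{|x| >
s}`, whose `dφ`-mass is `φ` of that length. -/
theorem lorentzNorm_eq_cakeNorm {φ : ℝ → ℝ} (hmono : MonotoneOn φ (Icc 0 1))
    (hconc : ConcaveOn ℝ (Icc 0 1) φ) (h : ContinuousOn φ (Icc 0 1)) (hzero : φ 0 = 0)
    [IsProbabilityMeasure ν] :
    lorentzNorm φ hmono ν x = cakeNorm (slopeDistr φ) ν x := by
  have hms : MeasurableSet {p : ℝ × ℝ | ENNReal.ofReal p.2 < rearrangement ν x p.1} :=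
    measurableSet_lt (ENNReal.measurable_ofReal.comp measurable_snd)
      (rearrangement_antitone.measurable.comp measurable_fst)
  have hsf : SFinite (stieltjes φ hmono) := by unfold stieltjes; infer_instance
  calc lorentzNorm φ hmono ν x
      = ∫⁻ t, ∫⁻ s in Ioi (0 : ℝ), {s : ℝ | ENNReal.ofReal s < rearrangement ν x t}.indicator 1 s
          ∂volume ∂(stieltjes φ hmono) := by
        simp_rw [lintegral_indicator_ofReal_lt]; rfl
    _ = ∫⁻ s in Ioi (0 : ℝ), ∫⁻ t,
          {s : ℝ | ENNReal.ofReal s < rearrangement ν x t}.indicator 1 s ∂(stieltjes φ hmono) := by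
        refine lintegral_lintegral_swap (Measurable.aemeasurable ?_)
        exact (measurable_one.indicator hms : Measurable
          ({p : ℝ × ℝ | ENNReal.ofReal p.2 < rearrangement ν x p.1}.indicator
            (1 : ℝ × ℝ → ℝ≥0∞)))
    _ = cakeNorm (slopeDistr φ) ν x := by
        refine lintegral_congr fun s => ?_
        have hle : distr ν x s ≤ 1 := prob_le_one
        have hfin : distr ν x s ≠ ∞ := ne_top_of_le_ne_top ENNReal.one_ne_top hle
        have hd : (distr ν x s).toReal ∈ Icc (0 : ℝ) 1 :=
          ⟨ENNReal.toReal_nonneg, ENNReal.toReal_le_of_le_ofReal zero_le_one (by simpa using hle)⟩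
        have hmt : MeasurableSet {t : ℝ | ENNReal.ofReal s < rearrangement ν x t} :=
          measurableSet_lt measurable_const rearrangement_antitone.measurable
        have e1 : (fun t : ℝ => {s : ℝ | ENNReal.ofReal s < rearrangement ν x t}.indicator
            (1 : ℝ → ℝ≥0∞) s) = {t : ℝ | ENNReal.ofReal s < rearrangement ν x t}.indicator 1 := by
          ext t; simp [indicator]
        rw [e1, lintegral_indicator_one hmt]
        have e2 : stieltjes φ hmono {t : ℝ | ENNReal.ofReal s < rearrangement ν x t} =
            stieltjes φ hmono (Iio (distr ν x s).toReal) := by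
          rw [stieltjes, Measure.restrict_apply hmt, Measure.restrict_apply measurableSet_Iio]
          congr 1
          ext t
          simp only [mem_inter_iff, mem_ofPred_eq, mem_Iio, and_congr_left_iff]
          intro ht
          rw [ofReal_lt_rearrangement_iff, ENNReal.ofReal_lt_iff_lt_toReal ht.1 hfin]
        rw [e2, stieltjes_inter_Iio hmono h hzero hd, ofReal_eq_mixMin hmono hconc h hzero hd,
          ENNReal.ofReal_toReal hfin]

end Rearrangement

/-! ### Concavity, doubling and continuity of `mixMin` -/

section MixMin

variable {a : ℝ → ℝ≥0∞}

theorem mixMin_mono {u v : ℝ≥0∞} (h : u ≤ v) : mixMin a u ≤ mixMin a v :=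
  lintegral_mono fun _ => min_le_min_right _ h

theorem mixMin_zero : mixMin a 0 = 0 := by simp [mixMin]

/-- Jensen's inequality, checked under the integral for each `u ↦ min (u, a r)`. Total weight below
one is allowed because the function vanishes at `0`. -/
theorem sum_mul_mixMin_le (ha : Measurable a) {ι : Type*} (s : Finset ι) (w u : ι → ℝ≥0∞)
    (hw : ∑ i ∈ s, w i ≤ 1) :
    ∑ i ∈ s, w i * mixMin a (u i) ≤ mixMin a (∑ i ∈ s, w i * u i) := by
  have hm : ∀ i, Measurable fun r => min (u i) (a r) := fun i => measurable_const.min ha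
  simp_rw [mixMin, ← lintegral_const_mul _ (hm _)]
  rw [← lintegral_finsetSum _ fun i _ => (hm i).const_mul _]
  refine lintegral_mono fun r => le_min ?_ ?_
  · exact Finset.sum_le_sum fun i _ => mul_le_mul_right (min_le_left _ _) _
  · calc ∑ i ∈ s, w i * min (u i) (a r) ≤ ∑ i ∈ s, w i * a r :=
          Finset.sum_le_sum fun i _ => mul_le_mul_right (min_le_right _ _) _
      _ = (∑ i ∈ s, w i) * a r := by rw [Finset.sum_mul]
      _ ≤ a r := by simpa using mul_le_mul_left hw (a r)

theorem mul_mixMin_le (ha : Measurable a) {w : ℝ≥0∞} (hw : w ≤ 1) (u : ℝ≥0∞) :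
    w * mixMin a u ≤ mixMin a (w * u) := by
  simpa using sum_mul_mixMin_le ha {()} (fun _ => w) (fun _ => u) (by simpa using hw)

/-- With `c = 2` this is the doubling property used to pass from dyadic to arbitrary measures. -/
theorem mixMin_mul_le (ha : Measurable a) {c : ℝ≥0∞} (hc : 1 ≤ c) (u : ℝ≥0∞) :
    mixMin a (c * u) ≤ c * mixMin a u := by
  rw [mixMin, mixMin, ← lintegral_const_mul _ (measurable_const.min ha)]
  refine lintegral_mono fun r => ?_
  rcases le_total u (a r) with h | h
  · rw [min_eq_left h]; exact min_le_left _ _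
  · rw [min_eq_right h]
    exact (min_le_right _ _).trans (by simpa using mul_le_mul_left hc (a r))

theorem mixMin_iSup (ha : Measurable a) {u : ℕ → ℝ≥0∞} (hu : Monotone u) :
    mixMin a (⨆ n, u n) = ⨆ n, mixMin a (u n) := by
  simp_rw [mixMin]
  rw [← lintegral_iSup (fun n => measurable_const.min ha)
    fun m n h r => min_le_min_right _ (hu h)]
  exact lintegral_congr fun r => iSup_inf_eq _ _

theorem tendsto_mixMin_zero (ha : Measurable a) (h1 : mixMin a 1 ≠ ∞) :
    Tendsto (mixMin a) (𝓝 0) (𝓝 0) := by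
  have h := tendsto_lintegral_filter_of_dominated_convergence (μ := volume.restrict (Ioi (0 : ℝ)))
    (F := fun (u : ℝ≥0∞) r => min u (a r)) (f := fun _ => 0) (l := 𝓝 0) (fun r => min 1 (a r))
    (Eventually.of_forall fun u => measurable_const.min ha) ?_ h1 ?_
  · simp only [lintegral_zero] at h
    exact h
  · filter_upwards [Iic_mem_nhds (zero_lt_one' ℝ≥0∞)] with u hu
    exact Eventually.of_forall fun r => min_le_min_right _ hu
  · refine Eventually.of_forall fun r => ?_
    refine tendsto_of_tendsto_of_tendsto_of_le_of_le tendsto_const_nhds tendsto_id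
      (fun _ => zero_le) fun u => min_le_left _ _

theorem measurable_mixMin : Measurable (mixMin a) :=
  Monotone.measurable fun _ _ h => mixMin_mono h

end MixMin

theorem ofReal_lt_enorm {s v : ℝ} (hs : 0 ≤ s) : ENNReal.ofReal s < ‖v‖ₑ ↔ s < |v| := by
  rw [Real.enorm_eq_ofReal_abs, ENNReal.ofReal_lt_ofReal_iff_of_nonneg hs]

theorem lintegral_Ioi_comp_mul {F : ℝ → ℝ≥0∞} (hF : Measurable F) {c : ℝ} (hc : 0 < c) :
    ∫⁻ s in Ioi (0 : ℝ), F (c * s) = ENNReal.ofReal c⁻¹ * ∫⁻ s in Ioi (0 : ℝ), F s := by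
  rw [← lintegral_indicator measurableSet_Ioi, ← lintegral_indicator measurableSet_Ioi]
  have h1 : (fun s => (Ioi (0 : ℝ)).indicator (fun s => F (c * s)) s) =
      fun s => (Ioi (0 : ℝ)).indicator F (c * s) := by
    ext s; simp [indicator, hc]
  rw [h1, ← lintegral_map (hF.indicator measurableSet_Ioi) (measurable_const_mul c),
    Real.map_volume_mul_left hc.ne', lintegral_smul_measure, abs_of_pos (inv_pos.2 hc), smul_eq_mul]

theorem lintegral_Ioi_comp_add {F : ℝ → ℝ≥0∞} (L : ℝ) :
    ∫⁻ s in Ioi (0 : ℝ), F (s + L) = ∫⁻ s in Ioi L, F s := by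
  rw [← lintegral_indicator measurableSet_Ioi, ← lintegral_indicator measurableSet_Ioi,
    ← lintegral_add_right_eq_self ((Ioi L).indicator _) L]
  congr 1; ext s; simp [indicator]

/-! ### The Lorentz norm: triangle inequality, comparison with `L¹`, truncation -/

section CakeNorm

variable {a : ℝ → ℝ≥0∞} {Ω : Type*} [MeasurableSpace Ω] {ν : Measure Ω} {x y : Ω → ℝ}

theorem measurable_distr : Measurable (distr ν x) := distr_antitone.measurable

theorem distr_mono_ae (h : ∀ᵐ u ∂ν, ‖x u‖ₑ ≤ ‖y u‖ₑ) (s : ℝ) : distr ν x s ≤ distr ν y s :=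
  measure_mono_ae (h.mono fun _ hu (hs : _ < _) => hs.trans_le hu)

theorem cakeNorm_mono_ae (h : ∀ᵐ u ∂ν, ‖x u‖ₑ ≤ ‖y u‖ₑ) : cakeNorm a ν x ≤ cakeNorm a ν y :=
  lintegral_mono fun s => mixMin_mono (distr_mono_ae h s)

theorem cakeNorm_congr_ae (h : x =ᵐ[ν] y) : cakeNorm a ν x = cakeNorm a ν y :=
  le_antisymm (cakeNorm_mono_ae (h.mono fun u hu => by rw [hu]))
    (cakeNorm_mono_ae (h.mono fun u hu => by rw [hu]))

theorem cakeNorm_eq_zero_of_ae (h : x =ᵐ[ν] 0) : cakeNorm a ν x = 0 := by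
  rw [cakeNorm_congr_ae h]
  simp [cakeNorm, distr, mixMin_zero]

theorem cakeNorm_const_mul (c : ℝ) : cakeNorm a ν (fun u => c * x u) = ‖c‖ₑ * cakeNorm a ν x := by
  rcases eq_or_ne c 0 with rfl | hc
  · rw [cakeNorm_eq_zero_of_ae (Eventually.of_forall fun u => by simp)]; simp
  have hc' : 0 < |c| := abs_pos.2 hc
  have h : ∀ s ∈ Ioi (0 : ℝ), mixMin a (distr ν (fun u => c * x u) s) =
      mixMin a (distr ν x (|c|⁻¹ * s)) := fun s hs => by
    refine congrArg (mixMin a) (congrArg ν ?_)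
    ext u
    have hs' : (0 : ℝ) ≤ |c|⁻¹ * s := mul_nonneg (inv_nonneg.2 hc'.le) (le_of_lt hs)
    simp only [mem_ofPred_eq, ofReal_lt_enorm (le_of_lt hs), ofReal_lt_enorm hs', abs_mul]
    rw [inv_mul_lt_iff₀ hc']
  rw [cakeNorm, setLIntegral_congr_fun measurableSet_Ioi h,
    lintegral_Ioi_comp_mul (F := fun s => mixMin a (distr ν x s))
      (measurable_mixMin.comp measurable_distr) (inv_pos.2 hc'),
    inv_inv, Real.enorm_eq_ofReal_abs, cakeNorm]

theorem cakeNorm_neg : cakeNorm a ν (fun u => -x u) = cakeNorm a ν x := by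
  simpa using cakeNorm_const_mul (a := a) (ν := ν) (x := x) (-1)

theorem lintegral_enorm_sub (hx : AEMeasurable x ν) (L : ℝ≥0) :
    ∫⁻ u, (‖x u‖ₑ - L) ∂ν = ∫⁻ s in Ioi (L : ℝ), distr ν x s := by
  have h1 : ∀ u, ‖x u‖ₑ - L = ENNReal.ofReal (max (|x u| - L) 0) := fun u => by
    rw [Real.enorm_eq_ofReal_abs, ← ENNReal.ofReal_coe_nnreal, ← ENNReal.ofReal_sub _ L.coe_nonneg,
      ENNReal.ofReal_max, ENNReal.ofReal_zero, max_eq_left zero_le]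
  simp_rw [h1]
  rw [lintegral_eq_lintegral_meas_lt (f := fun u => max (|x u| - L) 0) ν
    (Eventually.of_forall fun u => le_max_right _ _)
    ((by fun_prop : Continuous fun v : ℝ => max (|v| - L) 0).measurable.comp_aemeasurable hx),
    ← lintegral_Ioi_comp_add (F := distr ν x) (L : ℝ)]
  refine setLIntegral_congr_fun measurableSet_Ioi fun s hs => ?_
  have hs0 : (0 : ℝ) < s := hs
  have hsL : (0 : ℝ) ≤ s + L := add_nonneg hs0.le L.coe_nonneg
  refine congrArg ν ?_
  ext u
  simp only [mem_ofPred_eq, ofReal_lt_enorm hsL, lt_max_iff, not_lt.2 hs0.le, or_false]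
  exact lt_sub_iff_add_lt

theorem lintegral_enorm_eq (hx : AEMeasurable x ν) :
    ∫⁻ u, ‖x u‖ₑ ∂ν = ∫⁻ s in Ioi (0 : ℝ), distr ν x s := by
  simpa using lintegral_enorm_sub hx 0

/-- `∫₀^b x^*(t) dt`, in terms of the distribution function. -/
def truncNorm (ν : Measure Ω) (x : Ω → ℝ) (b : ℝ≥0∞) : ℝ≥0∞ :=
  ∫⁻ s in Ioi (0 : ℝ), min (distr ν x s) b

theorem cakeNorm_eq_truncNorm (ha : Measurable a) :
    cakeNorm a ν x = ∫⁻ r in Ioi (0 : ℝ), truncNorm ν x (a r) := by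
  refine lintegral_lintegral_swap (Measurable.aemeasurable ?_)
  exact (measurable_distr.comp measurable_fst).min (ha.comp measurable_snd)

theorem lintegral_Ioi_split (F : ℝ → ℝ≥0∞) (L : ℝ≥0) : ∫⁻ s in Ioi (0 : ℝ), F s =
    (∫⁻ s in Ioc 0 (L : ℝ), F s) + ∫⁻ s in Ioi (L : ℝ), F s := by
  rw [← lintegral_union measurableSet_Ioi, Ioc_union_Ioi_eq_Ioi L.coe_nonneg]
  rw [Set.disjoint_left]
  exact fun s h h' => absurd h.2 (not_le.2 h')

/-- Together with `exists_truncNorm_eq` this identifies `truncNorm` as the minimum over `L` of `b L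
+ ∫ (|x| - L)₊`, the K-functional of the couple `(L¹, L^∞)`. Below height `L` the integrand is
bounded by `b`, above it by the distribution function. -/
theorem truncNorm_le (hx : AEMeasurable x ν) (b : ℝ≥0∞) (L : ℝ≥0) :
    truncNorm ν x b ≤ b * L + ∫⁻ u, (‖x u‖ₑ - L) ∂ν := by
  rw [truncNorm, lintegral_Ioi_split _ L, lintegral_enorm_sub hx]
  refine add_le_add ?_ (lintegral_mono fun _ => min_le_left (distr ν x _) b)
  calc _ ≤ ∫⁻ s in Ioc 0 (L : ℝ), b := lintegral_mono fun _ => min_le_right _ _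
    _ = b * L := by simp

theorem tendsto_distr_atTop [IsFiniteMeasure ν] (hx : AEMeasurable x ν) :
    Tendsto (fun n : ℕ => distr ν x n) atTop (𝓝 0) := by
  have h := tendsto_measure_iInter_atTop (μ := ν)
    (s := fun n : ℕ => {u | ENNReal.ofReal n < ‖x u‖ₑ})
    (fun n => nullMeasurableSet_lt aemeasurable_const hx.enorm)
    (fun m n h u hu => (ENNReal.ofReal_le_ofReal (by exact_mod_cast h)).trans_lt hu)
    ⟨0, measure_ne_top _ _⟩
  have he : ⋂ n : ℕ, {u | ENNReal.ofReal n < ‖x u‖ₑ} = ∅ := by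
    refine eq_empty_of_forall_notMem fun u hu => ?_
    obtain ⟨n, hn⟩ := exists_nat_ge |x u|
    have := mem_iInter.1 hu n
    rw [mem_ofPred_eq, ofReal_lt_enorm n.cast_nonneg] at this
    linarith
  rw [he, measure_empty] at h
  exact h

/-- The optimal height is the rearrangement at `b`: the distribution function exceeds `b` below it
and is at most `b` above it. For `b = 0` an unbounded function has no admissible height. -/
theorem exists_truncNorm_eq [IsFiniteMeasure ν] (hx : AEMeasurable x ν) {b : ℝ≥0∞} (hb : b ≠ 0) :
    ∃ L : ℝ≥0, truncNorm ν x b = b * L + ∫⁻ u, (‖x u‖ₑ - L) ∂ν := by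
  set T : Set ℝ≥0 := {s | distr ν x s ≤ b}
  have hne : T.Nonempty := by
    obtain ⟨n, hn⟩ := ((tendsto_distr_atTop hx).eventually (Iic_mem_nhds hb.bot_lt)).exists
    exact ⟨n, by simpa [T] using hn⟩
  refine ⟨sInf T, ?_⟩
  rw [truncNorm, lintegral_Ioi_split _ (sInf T), lintegral_enorm_sub hx]
  congr 1
  · calc ∫⁻ s in Ioc 0 ((sInf T : ℝ≥0) : ℝ), min (distr ν x s) b
        = ∫⁻ s in Ioo 0 ((sInf T : ℝ≥0) : ℝ), min (distr ν x s) b := by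
          rw [restrict_Ioo_eq_restrict_Ioc]
      _ = ∫⁻ s in Ioo 0 ((sInf T : ℝ≥0) : ℝ), b := by
          refine setLIntegral_congr_fun measurableSet_Ioo fun s hs => min_eq_right ?_
          have h1 : Real.toNNReal s < sInf T := (Real.toNNReal_lt_iff_lt_coe hs.1.le).2 hs.2
          have h2 := notMem_of_lt_csInf h1 (OrderBot.bddBelow T)
          have h3 : ¬ distr ν x (Real.toNNReal s) ≤ b := h2
          rw [Real.coe_toNNReal s hs.1.le] at h3
          exact (not_le.1 h3).le
      _ = b * (sInf T : ℝ≥0) := by simp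
  · refine setLIntegral_congr_fun measurableSet_Ioi fun s hs => min_eq_left ?_
    have hs0 : (0 : ℝ) ≤ s := (sInf T).coe_nonneg.trans (le_of_lt hs)
    have h1 : sInf T < Real.toNNReal s := Real.lt_toNNReal_iff_coe_lt.2 hs
    obtain ⟨s', hs', hlt⟩ := exists_lt_of_csInf_lt hne h1
    exact (distr_antitone (Real.lt_toNNReal_iff_coe_lt.1 hlt).le).trans hs'

/-- Take optimal heights `L`, `M` for the summands, test the sum with `L + M`, and use `(|x + y| - L
- M)₊ ≤ (|x| - L)₊ + (|y| - M)₊`. Integrating in `r` with `b = a r` then gives the triangle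
inequality of the norm. -/
theorem truncNorm_add_le [IsFiniteMeasure ν] (hx : AEMeasurable x ν) (hy : AEMeasurable y ν)
    (b : ℝ≥0∞) :
    truncNorm ν (fun u => x u + y u) b ≤ truncNorm ν x b + truncNorm ν y b := by
  rcases eq_or_ne b 0 with rfl | hb
  · simp [truncNorm]
  obtain ⟨L, hL⟩ := exists_truncNorm_eq hx hb
  obtain ⟨M, hM⟩ := exists_truncNorm_eq hy hb
  rw [hL, hM]
  calc truncNorm ν (fun u => x u + y u) b
      ≤ b * (L + M : ℝ≥0) + ∫⁻ u, (‖x u + y u‖ₑ - (L + M : ℝ≥0)) ∂ν := truncNorm_le (hx.add hy) b _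
    _ ≤ b * (L + M : ℝ≥0) + ∫⁻ u, ((‖x u‖ₑ - L) + (‖y u‖ₑ - M)) ∂ν := by
        gcongr with u
        rw [ENNReal.coe_add]
        exact (tsub_le_tsub_right (enorm_add_le _ _) _).trans add_tsub_add_le_tsub_add_tsub
    _ = _ := by
        rw [lintegral_add_left' (f := fun u => ‖x u‖ₑ - L) (hx.enorm.sub aemeasurable_const), ENNReal.coe_add, mul_add]
        abel

theorem cakeNorm_add_le [IsFiniteMeasure ν] (ha : Measurable a) (hx : AEMeasurable x ν)
    (hy : AEMeasurable y ν) :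
    cakeNorm a ν (fun u => x u + y u) ≤ cakeNorm a ν x + cakeNorm a ν y := by
  have hm : Measurable fun r => truncNorm ν x (a r) :=
    (Monotone.measurable (fun _ _ h => lintegral_mono fun _ => min_le_min_left _ h :
      Monotone (truncNorm ν x))).comp ha
  rw [cakeNorm_eq_truncNorm ha, cakeNorm_eq_truncNorm ha, cakeNorm_eq_truncNorm ha,
    ← lintegral_add_left hm]
  exact lintegral_mono fun r => truncNorm_add_le hx hy _

theorem cakeNorm_sub_le [IsFiniteMeasure ν] (ha : Measurable a) (hx : AEMeasurable x ν)
    (hy : AEMeasurable y ν) :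
    cakeNorm a ν (fun u => x u - y u) ≤ cakeNorm a ν x + cakeNorm a ν y := by
  have := cakeNorm_add_le (y := fun u => -y u) ha hx hy.neg
  rw [cakeNorm_neg] at this
  simpa [sub_eq_add_neg] using this

theorem cakeNorm_sum_le [IsFiniteMeasure ν] (ha : Measurable a) {ι : Type*} (s : Finset ι)
    (z : ι → Ω → ℝ) (hz : ∀ i, AEMeasurable (z i) ν) :
    cakeNorm a ν (fun u => ∑ i ∈ s, z i u) ≤ ∑ i ∈ s, cakeNorm a ν (z i) := by
  classical
  induction s using Finset.induction_on with
  | empty => rw [cakeNorm_eq_zero_of_ae (Eventually.of_forall fun u => by simp)]; simp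
  | insert i s hi ih =>
    simp_rw [Finset.sum_insert hi]
    exact (cakeNorm_add_le ha (hz i) (Finset.aemeasurable_fun_sum s fun j _ => hz j)).trans
      (by gcongr)

/-- Concavity gives `φ(d) ≥ d φ(1)`, so the Lorentz space embeds in `L¹`. -/
theorem mixMin_one_mul_lintegral_le [IsProbabilityMeasure ν] (ha : Measurable a)
    (hx : AEMeasurable x ν) : mixMin a 1 * ∫⁻ u, ‖x u‖ₑ ∂ν ≤ cakeNorm a ν x := by
  rw [lintegral_enorm_eq hx, ← lintegral_const_mul _ measurable_distr]
  refine lintegral_mono fun s => ?_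
  have := mul_mixMin_le ha (w := distr ν x s) prob_le_one 1
  rwa [mul_one, mul_comm] at this

/-- Split the integral over heights at `ε`: below it the distribution function is at most `1`,
between `ε` and `B` at most its value at `ε`, and above `B` it vanishes. -/
theorem cakeNorm_le_of_bound [IsProbabilityMeasure ν] {B : ℝ≥0} (hB : ∀ᵐ u ∂ν, ‖x u‖ₑ ≤ B) (ε : ℝ≥0) :
    cakeNorm a ν x ≤ ε * mixMin a 1 + B * mixMin a (distr ν x ε) := by
  rw [cakeNorm, lintegral_Ioi_split _ ε]
  refine add_le_add ?_ ?_
  · calc _ ≤ ∫⁻ s in Ioc 0 (ε : ℝ), mixMin a 1 := lintegral_mono fun s => mixMin_mono prob_le_one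
      _ = _ := by simp [mul_comm]
  · calc ∫⁻ s in Ioi (ε : ℝ), mixMin a (distr ν x s)
        ≤ ∫⁻ s in Ioi (ε : ℝ), (Ioc 0 (B : ℝ)).indicator (fun _ => mixMin a (distr ν x ε)) s := by
          refine setLIntegral_mono' measurableSet_Ioi fun s hs => ?_
          have hs0 : (0 : ℝ) < s := ε.coe_nonneg.trans_lt hs
          by_cases hsB : s ≤ B
          · rw [indicator_of_mem (show s ∈ Ioc 0 (B : ℝ) from ⟨hs0, hsB⟩)]
            exact mixMin_mono (distr_antitone (le_of_lt hs))
          · have : distr ν x s = 0 := by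
              refine measure_eq_zero_iff_ae_notMem.2 (hB.mono fun u hu => ?_)
              rw [mem_ofPred_eq, not_lt]
              refine hu.trans ?_
              rw [← ENNReal.ofReal_coe_nnreal]
              exact ENNReal.ofReal_le_ofReal (le_of_not_ge hsB)
            simp [this, mixMin_zero]
      _ ≤ ∫⁻ s, (Ioc 0 (B : ℝ)).indicator (fun _ => mixMin a (distr ν x ε)) s :=
          setLIntegral_le_lintegral _ _
      _ = _ := by rw [lintegral_indicator measurableSet_Ioc]; simp [mul_comm]

theorem cakeNorm_le_bound_mul [IsProbabilityMeasure ν] {B : ℝ≥0} (hB : ∀ᵐ u ∂ν, ‖x u‖ₑ ≤ B) :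
    cakeNorm a ν x ≤ B * mixMin a 1 := by
  refine (cakeNorm_le_of_bound hB 0).trans ?_
  simp only [ENNReal.coe_zero, zero_mul, zero_add]
  gcongr
  exact mixMin_mono prob_le_one

/-- On uniformly bounded functions `L¹`-smallness forces smallness in norm: Chebyshev makes `{|x| >
ε}` small, and `φ` tends to `0` at `0`. This transfers `L¹` density and the law of large numbers to
the Lorentz norm. -/
theorem exists_cakeNorm_le_of_lintegral_le [IsProbabilityMeasure ν] (ha : Measurable a)
    (h1 : mixMin a 1 ≠ ∞) (B : ℝ≥0) {η : ℝ≥0∞} (hη : η ≠ 0) :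
    ∃ δ : ℝ≥0∞, δ ≠ 0 ∧ ∀ x : Ω → ℝ, AEMeasurable x ν → (∀ᵐ u ∂ν, ‖x u‖ₑ ≤ B) →
      ∫⁻ u, ‖x u‖ₑ ∂ν ≤ δ → cakeNorm a ν x ≤ η := by
  have hη2 : η / 2 ≠ 0 := (ENNReal.half_pos hη).ne'
  obtain ⟨ε, hε0, hε⟩ : ∃ ε : ℝ≥0, 0 < ε ∧ (ε : ℝ≥0∞) * mixMin a 1 ≤ η / 2 := by
    have : Tendsto (fun ε : ℝ≥0 => (ε : ℝ≥0∞) * mixMin a 1) (𝓝[>] 0) (𝓝 0) := by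
      have h := ENNReal.Tendsto.mul_const (b := mixMin a 1) (f := 𝓝[>] (0 : ℝ≥0))
        (m := fun ε : ℝ≥0 => (ε : ℝ≥0∞)) (a := 0)
        ((ENNReal.tendsto_coe.2 tendsto_id).mono_left nhdsWithin_le_nhds) (Or.inr h1)
      simpa using h
    obtain ⟨ε, h, h'⟩ := ((this.eventually (Iic_mem_nhds hη2.bot_lt)).and
      self_mem_nhdsWithin).exists
    exact ⟨ε, h', h⟩
  obtain ⟨d, hd0, hd⟩ : ∃ d : ℝ≥0∞, d ≠ 0 ∧ (B : ℝ≥0∞) * mixMin a d ≤ η / 2 := by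
    have h : Tendsto (fun d : ℝ≥0∞ => (B : ℝ≥0∞) * mixMin a d) (𝓝[>] 0) (𝓝 0) := by
      have h := ENNReal.Tendsto.const_mul (a := (B : ℝ≥0∞))
        ((tendsto_mixMin_zero ha h1).mono_left (nhdsWithin_le_nhds (s := Ioi 0)))
        (Or.inr ENNReal.coe_ne_top)
      simpa using h
    obtain ⟨d, h, h'⟩ := ((h.eventually (Iic_mem_nhds hη2.bot_lt)).and
      self_mem_nhdsWithin).exists
    exact ⟨d, ne_of_gt h', h⟩
  have hε' : (ε : ℝ≥0∞) ≠ 0 := by exact_mod_cast hε0.ne'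
  refine ⟨ε * d, mul_ne_zero hε' hd0, fun x hx hB hint => ?_⟩
  refine (cakeNorm_le_of_bound hB ε).trans ?_
  rw [← ENNReal.add_halves η]
  refine add_le_add hε (le_trans ?_ hd)
  gcongr
  refine mixMin_mono ?_
  have hmarkov : (ε : ℝ≥0∞) * distr ν x ε ≤ ε * d := by
    refine le_trans ?_ hint
    refine le_trans ?_ (mul_meas_ge_le_lintegral₀ hx.enorm ε)
    gcongr
    refine measure_mono fun u hu => ?_
    have : ENNReal.ofReal ε < ‖x u‖ₑ := hu
    rw [ENNReal.ofReal_coe_nnreal] at this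
    exact this.le
  exact (ENNReal.mul_le_mul_iff_right hε' ENNReal.coe_ne_top).1 hmarkov

theorem tendsto_cakeNorm_tail [IsProbabilityMeasure ν] (ha : Measurable a) (h1 : mixMin a 1 ≠ ∞)
    (hx : AEMeasurable x ν) (hfin : cakeNorm a ν x ≠ ∞) :
    Tendsto (fun n : ℕ => cakeNorm a ν ({u | (n : ℝ) < |x u|}.indicator x)) atTop (𝓝 0) := by
  have h := tendsto_lintegral_of_dominated_convergence (μ := volume.restrict (Ioi (0 : ℝ)))
    (F := fun (n : ℕ) s => mixMin a (distr ν ({u | (n : ℝ) < |x u|}.indicator x) s))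
    (f := fun _ => 0) (fun s => mixMin a (distr ν x s))
    (fun n => measurable_mixMin.comp measurable_distr) ?_ hfin ?_
  · simpa [cakeNorm] using h
  · refine fun n => Eventually.of_forall fun s => mixMin_mono (distr_mono_ae ?_ s)
    exact Eventually.of_forall fun u => enorm_indicator_le_enorm_self _ _
  · refine Eventually.of_forall fun s => (tendsto_mixMin_zero ha h1).comp ?_
    refine tendsto_of_tendsto_of_tendsto_of_le_of_le tendsto_const_nhds (tendsto_distr_atTop hx)
      (fun _ => zero_le) fun n => measure_mono fun u hu => ?_
    have hu' : u ∈ {u | (n : ℝ) < |x u|} := by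
      by_contra hnot
      rw [mem_ofPred_eq, indicator_of_notMem hnot] at hu
      simp at hu
    exact (ofReal_lt_enorm n.cast_nonneg).2 hu'

end CakeNorm

/-! ### The doubling map, binary digits and level functions -/

section Doubling

/-- The doubling map of the unit interval. -/
def dbl (t : ℝ) : ℝ := Int.fract (2 * t)

/-- The first binary digit of a point of the unit interval. -/
def digit (t : ℝ) : Bool := decide (1 / 2 ≤ t)

/-- The first `k` binary digits of a point of the unit interval. -/
def digits (k : ℕ) (t : ℝ) : Fin k → Bool := fun i => digit (dbl^[i] t)

instance : IsProbabilityMeasure leb := ⟨by simp [leb]⟩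

theorem leb_eq : leb = volume.restrict (Ico 0 1) := by
  rw [leb, restrict_Ico_eq_restrict_Icc]

theorem measurable_dbl : Measurable dbl := (measurable_const_mul 2).fract

theorem measurable_dbl_iterate (k : ℕ) : Measurable dbl^[k] := measurable_dbl.iterate k

theorem measurable_digit : Measurable digit := by
  refine measurable_to_bool ?_
  have : digit ⁻¹' {true} = Ici (1 / 2) := by ext t; simp [digit]
  rw [this]
  exact measurableSet_Ici

theorem measurable_digits (k : ℕ) : Measurable (digits k) :=
  measurable_pi_lambda _ fun i => measurable_digit.comp (measurable_dbl_iterate i)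

theorem digits_succ (k : ℕ) (t : ℝ) :
    digits (k + 1) t = Fin.cons (digit t) (digits k (dbl t)) := by
  ext i
  refine Fin.cases ?_ (fun i => ?_) i
  · simp [digits]
  · simp [digits]

theorem lintegral_scale {F : ℝ → ℝ≥0∞} (hF : Measurable F) (c : ℝ) :
    ∫⁻ t, F (2 * t - c) = 2⁻¹ * ∫⁻ t, F t := by
  have h := lintegral_map (μ := volume) (f := fun t => F (t - c)) (g := fun t : ℝ => 2 * t)
    (hF.comp (measurable_id.sub_const c)) (measurable_const_mul 2)
  rw [← h, Real.map_volume_mul_left two_ne_zero, lintegral_smul_measure,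
    lintegral_sub_right_eq_self F c, smul_eq_mul, abs_of_pos (by norm_num),
    ENNReal.ofReal_inv_of_pos two_pos]
  simp

/-- The first digit is a fair coin independent of `dbl t`: substitute `u = 2t` and `u = 2t - 1` on
the two halves. -/
theorem lintegral_digit_dbl {H : Bool → ℝ → ℝ≥0∞} (hH : ∀ b, Measurable (H b)) :
    ∫⁻ t, H (digit t) (dbl t) ∂leb = 2⁻¹ * ∑ b, ∫⁻ u, H b u ∂leb := by
  have key : ∀ b : Bool, ∫⁻ u, H b u ∂leb = ∫⁻ u, (Ico (0 : ℝ) 1).indicator (H b) u := fun b => by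
    rw [leb_eq, lintegral_indicator measurableSet_Ico]
  have hm : ∀ b : Bool, Measurable ((Ico (0 : ℝ) 1).indicator (H b)) := fun b =>
    (hH b).indicator measurableSet_Ico
  rw [Fintype.sum_bool, mul_add, key, key, ← lintegral_scale (hm true) 1,
    ← lintegral_scale (hm false) 0, ← lintegral_add_left
      (f := fun t => (Ico (0 : ℝ) 1).indicator (H true) (2 * t - 1)) ((hm true).comp ((measurable_const_mul 2).sub_const 1)), leb_eq,
    ← lintegral_indicator measurableSet_Ico]
  refine lintegral_congr fun t => ?_
  by_cases h0 : 0 ≤ t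
  swap
  · have h1 : t ∉ Ico (0 : ℝ) 1 := fun h => h0 h.1
    have h2 : 2 * t - 1 ∉ Ico (0 : ℝ) 1 := fun h => h0 (by linarith [h.1])
    have h3 : 2 * t - 0 ∉ Ico (0 : ℝ) 1 := fun h => h0 (by linarith [h.1])
    rw [indicator_of_notMem h1, indicator_of_notMem h2, indicator_of_notMem h3, add_zero]
  by_cases h12 : t < 1 / 2
  · have h1 : t ∈ Ico (0 : ℝ) 1 := ⟨h0, by linarith⟩
    have h2 : 2 * t - 1 ∉ Ico (0 : ℝ) 1 := fun h => by linarith [h.1]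
    have h3 : 2 * t - 0 ∈ Ico (0 : ℝ) 1 := ⟨by linarith, by linarith⟩
    have hd : digit t = false := by simpa [digit] using h12
    have hs : dbl t = 2 * t - 0 := by
      rw [dbl, sub_zero]; exact Int.fract_eq_self.2 ⟨by linarith, by linarith⟩
    rw [indicator_of_mem h1, indicator_of_notMem h2, indicator_of_mem h3, hd, hs, zero_add]
  by_cases h1' : t < 1
  · have h1 : t ∈ Ico (0 : ℝ) 1 := ⟨h0, h1'⟩
    have h2 : 2 * t - 1 ∈ Ico (0 : ℝ) 1 := ⟨by linarith, by linarith⟩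
    have h3 : 2 * t - 0 ∉ Ico (0 : ℝ) 1 := fun h => by linarith [h.2]
    have hd : digit t = true := by simpa [digit] using h12
    have hs : dbl t = 2 * t - 1 := by
      rw [dbl, ← Int.fract_sub_one]; exact Int.fract_eq_self.2 h2
    rw [indicator_of_mem h1, indicator_of_mem h2, indicator_of_notMem h3, hd, hs, add_zero]
  · have h1 : t ∉ Ico (0 : ℝ) 1 := fun h => h1' h.2
    have h2 : 2 * t - 1 ∉ Ico (0 : ℝ) 1 := fun h => h1' (by linarith [h.2])
    have h3 : 2 * t - 0 ∉ Ico (0 : ℝ) 1 := fun h => h1' (by linarith [h.2])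
    rw [indicator_of_notMem h1, indicator_of_notMem h2, indicator_of_notMem h3, add_zero]

theorem measurePreserving_dbl : MeasurePreserving dbl leb leb := by
  refine ⟨measurable_dbl, Measure.ext fun A hA => ?_⟩
  rw [Measure.map_apply measurable_dbl hA]
  have h := lintegral_digit_dbl (H := fun _ => A.indicator 1) fun _ => measurable_one.indicator hA
  have h' : (fun t => A.indicator (1 : ℝ → ℝ≥0∞) (dbl t)) = (dbl ⁻¹' A).indicator 1 := by
    rfl
  rw [h', lintegral_indicator_one (measurable_dbl hA), lintegral_indicator_one hA] at h
  rw [h, Fintype.sum_bool, ← two_mul, ← mul_assoc, ENNReal.inv_mul_cancel two_ne_zero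
    ENNReal.ofNat_ne_top, one_mul]

theorem measurePreserving_dbl_iterate (k : ℕ) : MeasurePreserving dbl^[k] leb leb :=
  measurePreserving_dbl.iterate k

theorem sum_cons {M : Type*} [AddCommMonoid M] {k : ℕ} (F : (Fin (k + 1) → Bool) → M) :
    ∑ α, F α = ∑ b : Bool, ∑ β : Fin k → Bool, F (Fin.cons b β) := by
  rw [← Fintype.sum_prod_type' (f := fun (b : Bool) (β : Fin k → Bool) => F (Fin.cons b β))]
  exact ((Fin.consEquiv (fun _ : Fin (k + 1) => Bool)).sum_comp F).symm

/-- Under Lebesgue measure the first `k` digits are uniform on the `2 ^ k` words and independent of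
`dbl^[k] t`, by induction from one digit. -/
theorem lintegral_digits (k : ℕ) {G : (Fin k → Bool) → ℝ → ℝ≥0∞} (hG : ∀ α, Measurable (G α)) :
    ∫⁻ t, G (digits k t) (dbl^[k] t) ∂leb = (2 ^ k)⁻¹ * ∑ α, ∫⁻ u, G α u ∂leb := by
  induction k with
  | zero =>
    simp only [pow_zero, inv_one, one_mul, Function.iterate_zero, id_eq, Fintype.sum_unique]
    exact lintegral_congr fun t => congrArg (fun α => G α t) (Subsingleton.elim _ _)
  | succ k ih =>
    have h := lintegral_digit_dbl (H := fun b u => G (Fin.cons b (digits k u)) (dbl^[k] u)) fun b =>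
      (measurable_from_prod_countable_right
        (f := fun p : (Fin k → Bool) × ℝ => G (Fin.cons b p.1) p.2) fun α => hG (Fin.cons b α)).comp
          ((measurable_digits k).prodMk (measurable_dbl_iterate k))
    simp only [digits_succ, Function.iterate_succ, Function.comp_apply]
    rw [h, sum_cons, pow_succ', ENNReal.mul_inv (Or.inl two_ne_zero) (Or.inl ENNReal.ofNat_ne_top),
      mul_assoc, Finset.mul_sum (s := Finset.univ) (a := (2 ^ k)⁻¹)]
    congr 1
    refine Finset.sum_congr rfl fun b _ => ?_
    exact ih fun α => hG _

theorem leb_digits_inter (k : ℕ) (P : (Fin k → Bool) → Set ℝ) (hP : ∀ α, MeasurableSet (P α)) :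
    leb {t | dbl^[k] t ∈ P (digits k t)} = (2 ^ k)⁻¹ * ∑ α, leb (P α) := by
  have hm : MeasurableSet {t | dbl^[k] t ∈ P (digits k t)} := by
    have h : Measurable fun p : (Fin k → Bool) × ℝ => (P p.1).indicator (1 : ℝ → ℝ≥0∞) p.2 :=
      measurable_from_prod_countable_right fun α => measurable_one.indicator (hP α)
    have h2 := (h.comp ((measurable_digits k).prodMk (measurable_dbl_iterate k)))
      (measurableSet_singleton 1)
    convert h2 using 1
    ext t
    by_cases ht : dbl^[k] t ∈ P (digits k t) <;> simp [ht]
  have h := lintegral_digits k (G := fun α => (P α).indicator 1)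
    fun α => measurable_one.indicator (hP α)
  simp_rw [lintegral_indicator_one (hP _)] at h
  rw [← h, ← lintegral_indicator_one hm]
  rfl

/-- The point `1/2` lies in both closed halves and `dbl 1 = 0`, so the identity is claimed only off
these points. -/
theorem V_ae (b : Bool) (g : ℝ → ℝ) :
    ∀ᵐ t ∂leb, V b g t = if digit t = b then g (dbl t) else 0 := by
  have h1 : ∀ᵐ t ∂leb, t ∈ Ico (0 : ℝ) 1 := by
    rw [leb_eq]; exact ae_restrict_mem measurableSet_Ico
  have h2 : ∀ᵐ t ∂leb, t ≠ 1 / 2 := by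
    rw [leb]; exact ae_restrict_of_ae (Measure.ae_ne volume _)
  filter_upwards [h1, h2] with t ht hne
  rcases lt_or_gt_of_ne hne with h12 | h12
  · have hd : digit t = false := by simpa [digit] using h12
    have hs : dbl t = 2 * t := Int.fract_eq_self.2 ⟨by linarith [ht.1], by linarith⟩
    rw [hd, hs]
    cases b
    · have : t ∈ Icc (0 : ℝ) (1 / 2) := ⟨ht.1, h12.le⟩
      simp only [V, if_pos this, if_true]
    · have : t ∉ Icc (1 / 2 : ℝ) 1 := fun h => absurd h.1 (not_le.2 h12)
      simp only [V, if_neg this]; simp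
  · have hd : digit t = true := by simpa [digit] using h12.le
    have hs : dbl t = 2 * t - 1 := by
      rw [dbl, ← Int.fract_sub_one]
      exact Int.fract_eq_self.2 ⟨by linarith, by linarith [ht.2]⟩
    rw [hd, hs]
    cases b
    · have : t ∉ Icc (0 : ℝ) (1 / 2) := fun h => absurd h.2 (not_le.2 h12)
      simp only [V, if_neg this]; simp
    · have : t ∈ Icc (1 / 2 : ℝ) 1 := ⟨h12.le, ht.2.le⟩
      simp only [V, if_pos this, if_true]

theorem Vpow_ae {f g : ℝ → ℝ} (hfg : f =ᵐ[leb] g) (α : List Bool) : ∀ᵐ t ∂leb, Vpow α f t =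
    if List.ofFn (digits α.length t) = α then g (dbl^[α.length] t) else 0 := by
  induction α with
  | nil => filter_upwards [hfg] with t ht; simpa [Vpow] using ht
  | cons b α ih =>
    have h := measurePreserving_dbl.quasiMeasurePreserving.ae ih
    filter_upwards [V_ae b (Vpow α f), h] with t h1 h2
    have h3 : Vpow (b :: α) f t = V b (Vpow α f) t := rfl
    rw [h3, h1, h2]
    simp only [List.length_cons, digits_succ, List.ofFn_cons, Function.iterate_succ,
      Function.comp_apply, List.cons.injEq]
    split_ifs <;> tauto

/-- The function which on every dyadic interval of rank `k` is the rescaled copy of `f`, multiplied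
by the coefficient of this interval. -/
def levelFn (k : ℕ) (c : (Fin k → Bool) → ℝ) (f : ℝ → ℝ) (t : ℝ) : ℝ :=
  c (digits k t) * f (dbl^[k] t)

theorem Vpow_ofFn_ae {f g : ℝ → ℝ} (hfg : f =ᵐ[leb] g) {k : ℕ} (α : Fin k → Bool) :
    ∀ᵐ t ∂leb, Vpow (List.ofFn α) f t = if digits k t = α then g (dbl^[k] t) else 0 := by
  -- The length is kept free because `digits (List.ofFn α).length t` and `digits k t` have different
  -- types.
  have key : ∀ (n : ℕ), n = k → ∀ t, (List.ofFn (digits n t) = List.ofFn α ↔ digits k t = α) := by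
    rintro n rfl t
    exact List.ofFn_injective.eq_iff
  filter_upwards [Vpow_ae hfg (List.ofFn α)] with t ht
  rw [ht]
  have hl : (List.ofFn α).length = k := List.length_ofFn
  refine if_congr (key _ hl t) (by rw [hl]) rfl

theorem sum_Vpow_ae {f g : ℝ → ℝ} (hfg : f =ᵐ[leb] g) (k : ℕ) (c : (Fin k → Bool) → ℝ) :
    (fun t => ∑ α : Fin k → Bool, c α * Vpow (List.ofFn α) f t) =ᵐ[leb] levelFn k c g := by
  filter_upwards [ae_all_iff.2 fun α : Fin k → Bool => Vpow_ofFn_ae hfg α] with t ht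
  simp_rw [ht]
  simp [levelFn]

theorem measurable_levelFn {f : ℝ → ℝ} (hf : Measurable f) (k : ℕ) (c : (Fin k → Bool) → ℝ) :
    Measurable (levelFn k c f) :=
  ((Measurable.of_discrete (f := c)).comp (measurable_digits k)).mul
    (hf.comp (measurable_dbl_iterate k))

theorem distr_levelFn {f : ℝ → ℝ} (hf : Measurable f) (k : ℕ) (c : (Fin k → Bool) → ℝ) (s : ℝ) :
    distr leb (levelFn k c f) s = (2 ^ k)⁻¹ * ∑ α, distr leb (fun u => c α * f u) s :=
  leb_digits_inter k (fun α => {u | ENNReal.ofReal s < ‖c α * f u‖ₑ}) fun _ =>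
    measurableSet_lt measurable_const (hf.const_mul _).enorm

theorem distr_comp {Ω : Type*} [MeasurableSpace Ω] {ν : Measure Ω} {T : Ω → Ω}
    (hT : MeasurePreserving T ν ν) {x : Ω → ℝ} (hx : AEMeasurable x ν) (s : ℝ) :
    distr ν (fun t => x (T t)) s = distr ν x s :=
  hT.measure_preimage (nullMeasurableSet_lt aemeasurable_const hx.enorm)

theorem cakeNorm_comp {a : ℝ → ℝ≥0∞} {Ω : Type*} [MeasurableSpace Ω] {ν : Measure Ω} {T : Ω → Ω}
    (hT : MeasurePreserving T ν ν) {x : Ω → ℝ} (hx : AEMeasurable x ν) :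
    cakeNorm a ν (fun t => x (T t)) = cakeNorm a ν x := by
  simp_rw [cakeNorm, distr_comp hT hx]

theorem distr_tensor {f y : ℝ → ℝ} (hf : Measurable f) (hy : Measurable y) (s : ℝ) :
    distr (leb.prod leb) (tensor f y) s = ∫⁻ t, distr leb (fun u => y t * f u) s ∂leb := by
  have hm : MeasurableSet {p : ℝ × ℝ | ENNReal.ofReal s < ‖tensor f y p‖ₑ} :=
    measurableSet_lt measurable_const
      ((hf.comp measurable_fst).mul (hy.comp measurable_snd)).enorm
  rw [distr, Measure.prod_apply_symm hm]
  simp only [tensor, distr, preimage_ofPred_eq, mul_comm]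

/-- By independence of `digits k` and `dbl^[k]`, the level function on `[0, 1]` and the tensor
product on the square are equimeasurable. -/
theorem cakeNorm_levelFn {a : ℝ → ℝ≥0∞} {f : ℝ → ℝ} (hf : Measurable f) (k : ℕ)
    (c : (Fin k → Bool) → ℝ) : cakeNorm a leb (levelFn k c f) =
      cakeNorm a (leb.prod leb) (tensor f fun t => c (digits k t)) := by
  have hc : Measurable fun t => c (digits k t) :=
    (Measurable.of_discrete (f := c)).comp (measurable_digits k)
  refine lintegral_congr fun s => congrArg (mixMin a) ?_
  rw [distr_levelFn hf, distr_tensor hf hc]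
  have h := lintegral_digits k (G := fun α _ => distr leb (fun u => c α * f u) s)
    fun α => measurable_const
  rw [h]
  simp

theorem indepFun_digits (m : ℕ) : ProbabilityTheory.IndepFun (digits m) dbl^[m] leb := by
  rw [ProbabilityTheory.indepFun_iff_measure_inter_preimage_eq_mul]
  intro A B hA hB
  classical
  have h1 := leb_digits_inter m (fun α => if α ∈ A then B else ∅) fun α => by
    split_ifs <;> simp [hB]
  have h2 := leb_digits_inter m (fun α => if α ∈ A then univ else ∅) fun α => by
    split_ifs <;> simp
  have e1 : digits m ⁻¹' A ∩ dbl^[m] ⁻¹' B =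
      {t | dbl^[m] t ∈ if digits m t ∈ A then B else ∅} := by
    ext t; by_cases h : digits m t ∈ A <;> simp [h]
  have e2 : digits m ⁻¹' A = {t | dbl^[m] t ∈ if digits m t ∈ A then univ else ∅} := by
    ext t; by_cases h : digits m t ∈ A <;> simp [h]
  rw [e1, h1, e2, h2, (measurePreserving_dbl_iterate m).measure_preimage hB.nullMeasurableSet,
    mul_assoc, Finset.sum_mul]
  congr 1
  refine Finset.sum_congr rfl fun α _ => ?_
  split_ifs <;> simp

end Doubling

/-! ### Density of dyadic step functions and the law of large numbers in norm -/

section Approximation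

variable {a : ℝ → ℝ≥0∞}

/-- The left endpoint of a dyadic interval. -/
def leftEndpoint : (k : ℕ) → (Fin k → Bool) → ℝ
  | 0, _ => 0
  | k + 1, α => ((if α 0 then 1 else 0) + leftEndpoint k (Fin.tail α)) / 2

theorem abs_sub_leftEndpoint_le (k : ℕ) : ∀ t ∈ Ico (0 : ℝ) 1,
    |t - leftEndpoint k (digits k t)| ≤ (1 / 2) ^ k := by
  induction k with
  | zero => intro t ht; simpa [leftEndpoint, abs_of_nonneg ht.1] using ht.2.le
  | succ k ih =>
    intro t ht
    have hS : dbl t ∈ Ico (0 : ℝ) 1 := ⟨Int.fract_nonneg _, Int.fract_lt_one _⟩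
    have h := ih _ hS
    have hdbl : t = ((if digit t then 1 else 0) + dbl t) / 2 := by
      by_cases h12 : 1 / 2 ≤ t
      · have hs : dbl t = 2 * t - 1 := by
          rw [dbl, ← Int.fract_sub_one]
          exact Int.fract_eq_self.2 ⟨by linarith, by linarith [ht.2]⟩
        have hd : digit t = true := by simpa [digit] using h12
        rw [hs, hd, if_pos rfl]; ring
      · have hs : dbl t = 2 * t := Int.fract_eq_self.2 ⟨by linarith [ht.1], by linarith⟩
        have hd : digit t = false := by simpa [digit] using h12
        rw [hs, hd]; simp
    have h2 : t - leftEndpoint (k + 1) (digits (k + 1) t) =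
        (dbl t - leftEndpoint k (digits k (dbl t))) / 2 := by
      rw [leftEndpoint, digits_succ, Fin.cons_zero, Fin.tail_cons]
      nth_rewrite 1 [hdbl]
      ring
    rw [h2, abs_div, abs_two, pow_succ]
    linarith

theorem measurable_comp_digits {k : ℕ} (c : (Fin k → Bool) → ℝ) :
    Measurable fun t => c (digits k t) :=
  (Measurable.of_discrete (f := c)).comp (measurable_digits k)

theorem exists_step_lintegral_sub_le {x : ℝ → ℝ} (hx : AEMeasurable x leb) {B : ℝ≥0}
    (hB : ∀ t, |x t| ≤ B) {δ : ℝ≥0∞} (hδ : δ ≠ 0) :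
    ∃ (r : ℕ) (c : (Fin r → Bool) → ℝ), (∀ α, |c α| ≤ B) ∧
      ∫⁻ t, ‖x t - c (digits r t)‖ₑ ∂leb ≤ δ := by
  have hδ2 : δ / 2 ≠ 0 := (ENNReal.half_pos hδ).ne'
  have hint : Integrable x leb := Integrable.of_bound hx.aestronglyMeasurable (B : ℝ)
    (Eventually.of_forall hB)
  obtain ⟨g, hg, -⟩ := hint.exists_boundedContinuous_lintegral_sub_le hδ2
  -- Clipping to `[-B, B]` does not move the approximant away from `x`, which takes values there,
  -- and it secures a uniform bound on the step values.
  set h : ℝ → ℝ := fun t => max (-B) (min B (g t)) with hh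
  have hcont : Continuous h := by have := g.continuous; fun_prop
  have hbound : ∀ t, |h t| ≤ B := fun t => by
    rw [abs_le]
    refine ⟨le_max_left _ _, max_le ?_ (min_le_left _ _)⟩
    linarith [B.coe_nonneg]
  have hclose : ∀ t, ‖x t - h t‖ₑ ≤ ‖x t - g t‖ₑ := fun t => by
    rw [Real.enorm_eq_ofReal_abs, Real.enorm_eq_ofReal_abs]
    refine ENNReal.ofReal_le_ofReal ?_
    obtain ⟨hl, hu⟩ := abs_le.1 (hB t)
    rw [hh]
    rcases max_cases (-(B : ℝ)) (min B (g t)) with h1 | h1 <;>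
    rcases min_cases (B : ℝ) (g t) with h2 | h2 <;>
    rcases abs_cases (x t - max (-(B : ℝ)) (min B (g t))) with h3 | h3 <;>
    rcases abs_cases (x t - g t) with h4 | h4 <;> linarith
  have hlim : Tendsto (fun r : ℕ => ∫⁻ t, ‖h t - h (leftEndpoint r (digits r t))‖ₑ ∂leb) atTop
      (𝓝 0) := by
    have := tendsto_lintegral_of_dominated_convergence (μ := leb)
      (F := fun (r : ℕ) t => ‖h t - h (leftEndpoint r (digits r t))‖ₑ) (f := fun _ => 0)
      (fun _ => 2 * B) ?_ ?_ ?_ ?_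
    · simpa using this
    · intro r
      exact (hcont.measurable.sub
        (measurable_comp_digits fun α => h (leftEndpoint r α))).enorm
    · refine fun r => Eventually.of_forall fun t => ?_
      refine (enorm_sub_le).trans ?_
      rw [two_mul, Real.enorm_eq_ofReal_abs, Real.enorm_eq_ofReal_abs]
      refine add_le_add ?_ ?_ <;>
      · rw [← ENNReal.ofReal_coe_nnreal]
        exact ENNReal.ofReal_le_ofReal (hbound _)
    · rw [lintegral_const, measure_univ, mul_one]
      exact ENNReal.mul_ne_top ENNReal.ofNat_ne_top ENNReal.coe_ne_top
    · have h1 : ∀ᵐ t ∂leb, t ∈ Ico (0 : ℝ) 1 := by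
        rw [leb_eq]; exact ae_restrict_mem measurableSet_Ico
      filter_upwards [h1] with t ht
      have hpt : Tendsto (fun r => leftEndpoint r (digits r t)) atTop (𝓝 t) := by
        rw [tendsto_iff_dist_tendsto_zero]
        refine squeeze_zero (fun _ => dist_nonneg) (fun r => ?_)
          (tendsto_pow_atTop_nhds_zero_of_lt_one (by norm_num : (0 : ℝ) ≤ 1 / 2) (by norm_num))
        rw [dist_comm, Real.dist_eq]
        exact abs_sub_leftEndpoint_le r t ht
      have h2 : Tendsto (fun r => h t - h (leftEndpoint r (digits r t))) atTop (𝓝 (h t - h t)) :=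
        tendsto_const_nhds.sub ((hcont.tendsto t).comp hpt)
      rw [sub_self] at h2
      simpa using h2.enorm
  obtain ⟨r, hr⟩ := (hlim.eventually (Iic_mem_nhds hδ2.bot_lt)).exists
  refine ⟨r, fun α => h (leftEndpoint r α), fun α => hbound _, ?_⟩
  calc ∫⁻ t, ‖x t - h (leftEndpoint r (digits r t))‖ₑ ∂leb
      ≤ ∫⁻ t, (‖x t - g t‖ₑ + ‖h t - h (leftEndpoint r (digits r t))‖ₑ) ∂leb := by
        refine lintegral_mono fun t => ?_
        rw [← sub_add_sub_cancel (x t) (h t)]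
        exact (enorm_add_le _ _).trans (add_le_add_left (hclose t) _)
    _ ≤ δ / 2 + δ / 2 := by
        rw [lintegral_add_right]
        · exact add_le_add hg hr
        · exact (hcont.measurable.sub
            (measurable_comp_digits fun α => h (leftEndpoint r α))).enorm
    _ = δ := ENNReal.add_halves δ

theorem enorm_le_coe_iff_abs {v : ℝ} {B : ℝ≥0} : ‖v‖ₑ ≤ B ↔ |v| ≤ B := by
  rw [Real.enorm_eq_ofReal_abs, ← ENNReal.ofReal_coe_nnreal,
    ENNReal.ofReal_le_ofReal_iff B.coe_nonneg]

/-- Cut off the large values of `x`, whose norm tends to zero, and approximate the bounded remainder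
in `L¹`; for uniformly bounded differences this is approximation in norm. -/
theorem exists_step_cakeNorm_sub_le (ha : Measurable a) (h1 : mixMin a 1 ≠ ∞) {x : ℝ → ℝ}
    (hx : AEMeasurable x leb) (hfin : cakeNorm a leb x ≠ ∞) {η : ℝ≥0∞} (hη : η ≠ 0) :
    ∃ (r : ℕ) (c : (Fin r → Bool) → ℝ), cakeNorm a leb (fun t => x t - c (digits r t)) ≤ η := by
  wlog hxm : Measurable x generalizing x
  · obtain ⟨r, c, hc⟩ := this hx.measurable_mk.aemeasurable
      (by rwa [← cakeNorm_congr_ae hx.ae_eq_mk]) hx.measurable_mk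
    refine ⟨r, c, ?_⟩
    rwa [cakeNorm_congr_ae (hx.ae_eq_mk.mono fun t ht => by rw [ht])]
  have hη2 : η / 2 ≠ 0 := (ENNReal.half_pos hη).ne'
  obtain ⟨n, hn⟩ := ((tendsto_cakeNorm_tail ha h1 hx hfin).eventually
    (Iic_mem_nhds hη2.bot_lt)).exists
  have hms : MeasurableSet {u | (n : ℝ) < |x u|} := measurableSet_lt measurable_const hxm.abs
  set x' : ℝ → ℝ := {u | (n : ℝ) < |x u|}ᶜ.indicator x with hx'
  have hx'm : Measurable x' := hxm.indicator hms.compl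
  have hx'B : ∀ t, |x' t| ≤ (n : ℝ≥0) := fun t => by
    by_cases ht : (n : ℝ) < |x t|
    · rw [hx', indicator_of_notMem (by simpa using ht)]; simp
    · rw [hx', indicator_of_mem (by simpa using ht)]; simpa using ht
  obtain ⟨δ, hδ, hδ'⟩ := exists_cakeNorm_le_of_lintegral_le (ν := leb) ha h1 (n + n) hη2
  obtain ⟨r, c, hcB, hc⟩ := exists_step_lintegral_sub_le hx'm.aemeasurable hx'B hδ
  refine ⟨r, c, ?_⟩
  have e : (fun t => x t - c (digits r t)) = fun t =>
      {u | (n : ℝ) < |x u|}.indicator x t + (x' t - c (digits r t)) := by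
    ext t
    rw [hx', ← add_sub_assoc, indicator_self_add_compl_apply]
  have hm2 : Measurable fun t => x' t - c (digits r t) := hx'm.sub (measurable_comp_digits c)
  rw [e]
  refine (cakeNorm_add_le ha (hxm.indicator hms).aemeasurable hm2.aemeasurable).trans ?_
  rw [← ENNReal.add_halves η]
  refine add_le_add hn (hδ' _ hm2.aemeasurable (Eventually.of_forall fun t => ?_) hc)
  rw [enorm_le_coe_iff_abs]
  exact (abs_sub _ _).trans (by simpa using add_le_add (hx'B t) (hcB _))

/-- The two functions read disjoint blocks of `m` digits. Removing the measure preserving `dbl^[i *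
m]` reduces the claim to the independence of `digits m` and `dbl^[m]`. -/
theorem indepFun_iterate {m : ℕ} (e : (Fin m → Bool) → ℝ) {i j : ℕ} (hij : i < j) :
    ProbabilityTheory.IndepFun (fun t => e (digits m (dbl^[i * m] t)))
      (fun t => e (digits m (dbl^[j * m] t))) leb := by
  obtain ⟨d, rfl⟩ := Nat.exists_eq_add_of_lt hij
  have hF : Measurable fun u => e (digits m (dbl^[d * m] u)) :=
    (measurable_comp_digits e).comp (measurable_dbl_iterate _)
  have h := (indepFun_digits m).comp (Measurable.of_discrete (f := e)) hF
  rw [ProbabilityTheory.indepFun_iff_measure_inter_preimage_eq_mul] at h ⊢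
  intro A B hA hB
  have hT := measurePreserving_dbl_iterate (i * m)
  have m1 : MeasurableSet ((e ∘ digits m) ⁻¹' A) := (measurable_comp_digits e) hA
  have m2 : MeasurableSet (((fun u => e (digits m (dbl^[d * m] u))) ∘ dbl^[m]) ⁻¹' B) :=
    (hF.comp (measurable_dbl_iterate m)) hB
  have e2 : (fun t => e (digits m (dbl^[(i + d + 1) * m] t))) =
      (fun u => e (digits m (dbl^[d * m] u))) ∘ dbl^[m] ∘ dbl^[i * m] := by
    ext t
    simp only [Function.comp_apply, ← Function.iterate_add_apply]
    congr 3; ring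
  have := h A B hA hB
  rw [← hT.measure_preimage (m1.inter m2).nullMeasurableSet,
    ← hT.measure_preimage m1.nullMeasurableSet,
    ← hT.measure_preimage m2.nullMeasurableSet] at this
  rw [e2]
  exact this

theorem tendsto_average_step (m : ℕ) (e : (Fin m → Bool) → ℝ) :
    Tendsto (fun n : ℕ => ∫⁻ t, ‖(n : ℝ)⁻¹ * (∑ j ∈ Finset.range n, e (digits m (dbl^[j * m] t))) -
      ∫ u, e (digits m u) ∂leb‖ₑ ∂leb) atTop (𝓝 0) := by
  have hm := measurable_comp_digits e
  have hb : ∃ B : ℝ, ∀ α, ‖e α‖ ≤ B := by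
    obtain ⟨B, hB⟩ := (Set.finite_range fun α => ‖e α‖).bddAbove
    exact ⟨B, fun α => hB ⟨α, rfl⟩⟩
  obtain ⟨B, hB⟩ := hb
  have h := ProbabilityTheory.strong_law_Lp (μ := leb) (p := 1) le_rfl ENNReal.one_ne_top
    (fun j t => e (digits m (dbl^[j * m] t))) ?_ ?_ ?_
  · simpa [eLpNorm_one_eq_lintegral_enorm] using h
  · exact MemLp.of_bound (by simpa using hm.aestronglyMeasurable) B
      (Eventually.of_forall fun t => hB _)
  · intro i j hij
    rcases lt_or_gt_of_ne hij with h | h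
    · exact indepFun_iterate e h
    · exact (indepFun_iterate e h).symm
  · intro j
    refine ⟨(hm.comp (measurable_dbl_iterate _)).aemeasurable,
      (hm.comp (measurable_dbl_iterate _)).aemeasurable, ?_⟩
    have key : ∀ k : ℕ, Measure.map (fun t => e (digits m (dbl^[k] t))) leb =
        Measure.map (fun t => e (digits m t)) leb := fun k => by
      have := Measure.map_map (μ := leb) hm (measurable_dbl_iterate k)
      rw [(measurePreserving_dbl_iterate k).map_eq] at this
      exact this.symm
    rw [key, key]

theorem integrable_of_cakeNorm (ha : Measurable a) (h0 : mixMin a 1 ≠ 0) {f : ℝ → ℝ}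
    (hf : AEMeasurable f leb) (hfin : cakeNorm a leb f ≠ ∞) : Integrable f leb := by
  refine ⟨hf.aestronglyMeasurable, ?_⟩
  have h := mixMin_one_mul_lintegral_le ha hf
  refine lt_top_iff_ne_top.2 fun htop => hfin ?_
  have h2 : ∫⁻ u, ‖f u‖ₑ ∂leb = ∞ := htop
  rw [h2, ENNReal.mul_top h0] at h
  exact top_le_iff.1 h

theorem exists_bound_of_finite {ι : Type*} [Finite ι] (e : ι → ℝ) : ∃ B : ℝ≥0, ∀ i, |e i| ≤ B := by
  obtain ⟨B, hB⟩ := (Set.finite_range fun i => Real.nnabs (e i)).bddAbove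
  exact ⟨B, fun i => by exact_mod_cast hB ⟨i, rfl⟩⟩

/-- Split `f` into a step function of `m` digits and a remainder `g` of small norm. The step part
averages independent blocks, so the strong law applies. Averages of `g` have norm at most `‖g‖`,
since `dbl` preserves measure, and the constant `∫ g` costs at most `φ(1) ‖g‖₁ ≤ ‖g‖`. -/
theorem exists_average_cakeNorm_le (ha : Measurable a) (h0 : mixMin a 1 ≠ 0) (h1 : mixMin a 1 ≠ ∞)
    {f : ℝ → ℝ} (hf : Measurable f) (hfin : cakeNorm a leb f ≠ ∞) {η : ℝ≥0∞} (hη : η ≠ 0) :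
    ∃ m n : ℕ, n ≠ 0 ∧ cakeNorm a leb (fun t => (n : ℝ)⁻¹ * (∑ j ∈ Finset.range n,
      f (dbl^[j * m] t)) - ∫ u, f u ∂leb) ≤ η := by
  have hη3 : η / 3 ≠ 0 := by simpa using hη
  obtain ⟨m, e, he⟩ := exists_step_cakeNorm_sub_le ha h1 hf.aemeasurable hfin hη3
  have hem := measurable_comp_digits e
  obtain ⟨B, hB⟩ := exists_bound_of_finite e
  have heint : Integrable (fun t => e (digits m t)) leb :=
    Integrable.of_bound hem.aestronglyMeasurable (B : ℝ) (Eventually.of_forall fun t => hB _)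
  have hmean : |∫ u, e (digits m u) ∂leb| ≤ B := by
    have := norm_integral_le_of_norm_le_const (μ := leb) (f := fun t => e (digits m t)) (C := B)
      (Eventually.of_forall fun t => hB _)
    simpa using this
  obtain ⟨δ, hδ, hδ'⟩ := exists_cakeNorm_le_of_lintegral_le (ν := leb) ha h1 (B + B) hη3
  obtain ⟨n, hn, hn0⟩ := (((tendsto_average_step m e).eventually (Iic_mem_nhds hδ.bot_lt)).and
    (eventually_ne_atTop 0)).exists
  refine ⟨m, n, hn0, ?_⟩
  have hn0' : (n : ℝ) ≠ 0 := by exact_mod_cast hn0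
  set g : ℝ → ℝ := fun t => f t - e (digits m t) with hg
  have hgm : Measurable g := hf.sub hem
  have hgint : ∫ u, g u ∂leb = ∫ u, f u ∂leb - ∫ u, e (digits m u) ∂leb :=
    integral_sub (integrable_of_cakeNorm ha h0 hf.aemeasurable hfin) heint
  have hsplit : (fun t => (n : ℝ)⁻¹ * (∑ j ∈ Finset.range n, f (dbl^[j * m] t)) - ∫ u, f u ∂leb) =
      fun t => ((n : ℝ)⁻¹ * (∑ j ∈ Finset.range n, g (dbl^[j * m] t)) +
        ((n : ℝ)⁻¹ * (∑ j ∈ Finset.range n, e (digits m (dbl^[j * m] t))) -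
          ∫ u, e (digits m u) ∂leb)) - ∫ u, g u ∂leb := by
    ext t
    rw [hgint]
    simp only [hg, Finset.sum_sub_distrib, mul_sub]
    ring
  have hgj : ∀ j : ℕ, Measurable fun t => g (dbl^[j * m] t) := fun j =>
    hgm.comp (measurable_dbl_iterate _)
  have hej : ∀ j : ℕ, Measurable fun t => e (digits m (dbl^[j * m] t)) := fun j =>
    hem.comp (measurable_dbl_iterate _)
  have m1 : Measurable fun t => (n : ℝ)⁻¹ * ∑ j ∈ Finset.range n, g (dbl^[j * m] t) :=
    (Finset.measurable_fun_sum _ fun j _ => hgj j).const_mul _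
  have m2 : Measurable fun t => (n : ℝ)⁻¹ * (∑ j ∈ Finset.range n, e (digits m (dbl^[j * m] t))) -
      ∫ u, e (digits m u) ∂leb :=
    ((Finset.measurable_fun_sum _ fun j _ => hej j).const_mul _).sub_const _
  have b1 : cakeNorm a leb (fun t => (n : ℝ)⁻¹ * ∑ j ∈ Finset.range n, g (dbl^[j * m] t)) ≤
      η / 3 := by
    rw [cakeNorm_const_mul]
    calc ‖(n : ℝ)⁻¹‖ₑ * cakeNorm a leb (fun t => ∑ j ∈ Finset.range n, g (dbl^[j * m] t))
        ≤ ‖(n : ℝ)⁻¹‖ₑ * ∑ j ∈ Finset.range n, cakeNorm a leb (fun t => g (dbl^[j * m] t)) := by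
          gcongr
          exact cakeNorm_sum_le ha _ _ fun j => (hgj j).aemeasurable
      _ = ‖(n : ℝ)⁻¹‖ₑ * (n * cakeNorm a leb g) := by
          simp_rw [cakeNorm_comp (measurePreserving_dbl_iterate _) hgm.aemeasurable]
          simp
      _ = cakeNorm a leb g := by
          rw [← mul_assoc, enorm_inv hn0', Real.enorm_natCast, ENNReal.inv_mul_cancel
            (by exact_mod_cast hn0) (ENNReal.natCast_ne_top n), one_mul]
      _ ≤ η / 3 := he
  have b2 : cakeNorm a leb (fun t => (n : ℝ)⁻¹ * (∑ j ∈ Finset.range n,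
      e (digits m (dbl^[j * m] t))) - ∫ u, e (digits m u) ∂leb) ≤ η / 3 := by
    refine hδ' _ m2.aemeasurable (Eventually.of_forall fun t => ?_) hn
    rw [enorm_le_coe_iff_abs]
    refine (abs_sub _ _).trans ?_
    rw [NNReal.coe_add]
    refine add_le_add ?_ hmean
    rw [abs_mul, abs_inv, Nat.abs_cast, inv_mul_le_iff₀ (by positivity)]
    refine (Finset.abs_sum_le_sum_abs _ _).trans ?_
    refine (Finset.sum_le_card_nsmul _ _ (B : ℝ) fun j _ => hB _).trans ?_
    simp
  have b3 : cakeNorm a leb (fun _ => ∫ u, g u ∂leb) ≤ η / 3 := by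
    refine (cakeNorm_le_bound_mul (B := ‖∫ u, g u ∂leb‖₊)
      (Eventually.of_forall fun _ => le_rfl)).trans ?_
    refine le_trans ?_ he
    refine le_trans ?_ (mixMin_one_mul_lintegral_le ha hgm.aemeasurable)
    rw [mul_comm]
    gcongr
    exact enorm_integral_le_lintegral_enorm _
  rw [hsplit]
  refine (cakeNorm_sub_le ha (m1.add m2).aemeasurable aemeasurable_const).trans ?_
  refine (add_le_add_left (cakeNorm_add_le ha m1.aemeasurable m2.aemeasurable) _).trans ?_
  refine (add_le_add (add_le_add b1 b2) b3).trans (le_of_eq ?_)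
  exact ENNReal.add_thirds η

end Approximation

/-! ### Sufficiency: greedy construction of the representation -/

section Representing

variable {a : ℝ → ℝ≥0∞} {f : ℝ → ℝ} {M : ℝ≥0∞}

/-- Coefficients of a step function of rank `r` on the dyadic intervals of rank `k ≥ r`. -/
def liftCoeff {r : ℕ} (c : (Fin r → Bool) → ℝ) (k : ℕ) (α : Fin k → Bool) : ℝ :=
  if h : r ≤ k then c fun i => α (Fin.castLE h i) else 0

theorem liftCoeff_digits {r k : ℕ} (h : r ≤ k) (c : (Fin r → Bool) → ℝ) (t : ℝ) :
    liftCoeff c k (digits k t) = c (digits r t) := by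
  rw [liftCoeff, dif_pos h]; rfl

theorem levelFn_zero (k : ℕ) : levelFn k 0 f = 0 := by ext t; simp [levelFn]

theorem levelFn_const_mul (k : ℕ) (w : ℝ) (c : (Fin k → Bool) → ℝ) :
    levelFn k (fun α => w * c α) f = fun t => w * levelFn k c f t := by
  ext t; simp [levelFn, mul_assoc]

theorem sum_levelFn (k : ℕ) {ι : Type*} (s : Finset ι) (c : ι → (Fin k → Bool) → ℝ) :
    levelFn k (fun α => ∑ i ∈ s, c i α) f = fun t => ∑ i ∈ s, levelFn k (c i) f t := by
  ext t; simp [levelFn, Finset.sum_mul]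

/-- A finite block of levels, beyond the level `K`, which halves the norm of a function. -/
theorem exists_block (ha : Measurable a) (h0 : mixMin a 1 ≠ 0) (h1 : mixMin a 1 ≠ ∞)
    (hf : Measurable f) (hfin : cakeNorm a leb f ≠ ∞) (hint : ∫ u, f u ∂leb ≠ 0)
    (hM : ∀ (k : ℕ) (c : (Fin k → Bool) → ℝ),
      cakeNorm a leb (levelFn k c f) ≤ M * cakeNorm a leb fun t => c (digits k t))
    {x : ℝ → ℝ} (hx : AEMeasurable x leb) (K : ℕ) :
    ∃ (K' : ℕ) (ξ : (k : ℕ) → (Fin k → Bool) → ℝ), K < K' ∧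
      cakeNorm a leb (fun t => x t - ∑ k ∈ Finset.Ico K K', levelFn k (ξ k) f t) ≤
        cakeNorm a leb x / 2 ∧
      ∑ k ∈ Finset.Ico K K', cakeNorm a leb (levelFn k (ξ k) f) ≤
        2 * M * ‖(∫ u, f u ∂leb)⁻¹‖ₑ * cakeNorm a leb x := by
  set I := ∫ u, f u ∂leb with hI
  set X := cakeNorm a leb x with hX
  -- If the norm is `0` or `∞`, one level of zero coefficients suffices. Otherwise `X / 4` is a
  -- legitimate error tolerance.
  have htriv : X = 0 ∨ X = ∞ → ∃ (K' : ℕ) (ξ : (k : ℕ) → (Fin k → Bool) → ℝ), K < K' ∧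
      cakeNorm a leb (fun t => x t - ∑ k ∈ Finset.Ico K K', levelFn k (ξ k) f t) ≤ X / 2 ∧
      ∑ k ∈ Finset.Ico K K', cakeNorm a leb (levelFn k (ξ k) f) ≤ 2 * M * ‖I⁻¹‖ₑ * X := by
    intro h
    refine ⟨K + 1, fun k => 0, Nat.lt_succ_self K, ?_, ?_⟩
    · simp only [levelFn_zero, Pi.zero_apply, Finset.sum_const_zero, sub_zero]
      rw [← hX]
      rcases h with h | h
      · simp [h]
      · simp [h, ENNReal.top_div]
    · simp only [levelFn_zero]
      rw [Finset.sum_eq_zero fun k _ => cakeNorm_eq_zero_of_ae (EventuallyEq.refl _ _)]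
      exact zero_le
  by_cases hX0 : X = 0
  · exact htriv (Or.inl hX0)
  by_cases hXtop : X = ∞
  · exact htriv (Or.inr hXtop)
  have hX4 : X / 4 ≠ 0 := by simpa using hX0
  obtain ⟨r, e, he⟩ := exists_step_cakeNorm_sub_le ha h1 hx hXtop hX4
  have hem := measurable_comp_digits e
  obtain ⟨B, hB⟩ := exists_bound_of_finite e
  -- `Q` bounds `|I⁻¹ e|`, the factor multiplying the averaging error; the added `1` keeps it
  -- nonzero for the division.
  set Q : ℝ≥0 := B * ‖I⁻¹‖₊ + 1 with hQ
  have hQ0 : (Q : ℝ≥0∞) ≠ 0 := by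
    have : Q ≠ 0 := by positivity
    exact_mod_cast this
  obtain ⟨m, n, hn0, havg⟩ := exists_average_cakeNorm_le (η := X / 4 / Q) ha h0 h1 hf hfin
    (ENNReal.div_ne_zero.2 ⟨hX4, ENNReal.coe_ne_top⟩)
  have hn0' : (n : ℝ) ≠ 0 := by exact_mod_cast hn0
  -- From level `r` on `e` is constant on the dyadic intervals; from level `K` on the block avoids
  -- the levels already used.
  set K0 := max r K with hK0
  set w : ℝ := I⁻¹ * (n : ℝ)⁻¹ with hw
  set K' := n * m + K0 + 1 with hK'
  -- Level `j * m + K0` carries `e / (n I)`. The sum over `j` adds up repeated contributions, since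
  -- all these levels coincide when `m = 0`.
  set ξ : (k : ℕ) → (Fin k → Bool) → ℝ := fun k α =>
    ∑ j ∈ Finset.range n, if j * m + K0 = k then w * liftCoeff e k α else 0 with hξ
  have hlevel : ∀ k, levelFn k (ξ k) f = fun t => ∑ j ∈ Finset.range n,
      if j * m + K0 = k then w * levelFn k (liftCoeff e k) f t else 0 := by
    intro k
    simp only [hξ]
    rw [sum_levelFn]
    ext t
    refine Finset.sum_congr rfl fun j _ => ?_
    split_ifs
    · rw [levelFn_const_mul]
    · exact congrFun (levelFn_zero k) t
  have hmem : ∀ j ∈ Finset.range n, j * m + K0 ∈ Finset.Ico K K' := by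
    intro j hj
    have : j * m ≤ n * m := Nat.mul_le_mul_right m (Finset.mem_range.1 hj).le
    rw [Finset.mem_Ico]
    refine ⟨(le_max_right r K).trans (Nat.le_add_left _ _), by omega⟩
  have hstep : ∀ j : ℕ, ∀ t, levelFn (j * m + K0) (liftCoeff e (j * m + K0)) f t =
      e (digits r t) * f (dbl^[j * m] (dbl^[K0] t)) := by
    intro j t
    rw [levelFn, liftCoeff_digits ((le_max_left r K).trans (Nat.le_add_left _ _)),
      Function.iterate_add_apply]
  refine ⟨K', ξ, ?_, ?_, ?_⟩
  · have := le_max_right r K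
    omega
  · set A : ℝ → ℝ := fun t => (n : ℝ)⁻¹ * (∑ j ∈ Finset.range n, f (dbl^[j * m] t)) - I with hA
    have hAm : Measurable A := ((Finset.measurable_fun_sum _ fun j _ =>
      hf.comp (measurable_dbl_iterate (j * m))).const_mul _).sub_const _
    -- The block reproduces `e` up to an averaging error multiplied by a bounded factor.
    have hsum : ∀ t, ∑ k ∈ Finset.Ico K K', levelFn k (ξ k) f t =
        e (digits r t) + I⁻¹ * e (digits r t) * A (dbl^[K0] t) := by
      intro t
      simp_rw [hlevel]
      rw [Finset.sum_comm]
      have : ∀ j ∈ Finset.range n, (∑ k ∈ Finset.Ico K K',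
          if j * m + K0 = k then w * levelFn k (liftCoeff e k) f t else 0) =
          w * (e (digits r t) * f (dbl^[j * m] (dbl^[K0] t))) := by
        intro j hj
        rw [Finset.sum_ite_eq, if_pos (hmem j hj), hstep]
      rw [Finset.sum_congr rfl this, ← Finset.mul_sum, ← Finset.mul_sum, hw, hA]
      field_simp
      ring
    have e1 : (fun t => x t - ∑ k ∈ Finset.Ico K K', levelFn k (ξ k) f t) =
        fun t => (x t - e (digits r t)) - I⁻¹ * e (digits r t) * A (dbl^[K0] t) := by
      ext t; rw [hsum]; ring
    have m2 : Measurable fun t => I⁻¹ * e (digits r t) * A (dbl^[K0] t) :=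
      (hem.const_mul _).mul (hAm.comp (measurable_dbl_iterate K0))
    have b2 : cakeNorm a leb (fun t => I⁻¹ * e (digits r t) * A (dbl^[K0] t)) ≤ X / 4 := by
      calc cakeNorm a leb (fun t => I⁻¹ * e (digits r t) * A (dbl^[K0] t))
          ≤ cakeNorm a leb (fun t => (Q : ℝ) * A (dbl^[K0] t)) := by
            refine cakeNorm_mono_ae (Eventually.of_forall fun t => ?_)
            rw [enorm_mul, enorm_mul (Q : ℝ)]
            gcongr
            rw [Real.enorm_eq_ofReal_abs, Real.enorm_eq_ofReal_abs]
            refine ENNReal.ofReal_le_ofReal ?_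
            rw [abs_mul, abs_of_nonneg Q.coe_nonneg, hQ]
            push_cast
            have := mul_le_mul_of_nonneg_left (hB (digits r t)) (abs_nonneg I⁻¹)
            rw [Real.norm_eq_abs]
            linarith
        _ = Q * cakeNorm a leb A := by
            rw [cakeNorm_const_mul, cakeNorm_comp (measurePreserving_dbl_iterate K0) hAm.aemeasurable]
            simp
        _ ≤ Q * (X / 4 / Q) := by gcongr
        _ = X / 4 := ENNReal.mul_div_cancel hQ0 ENNReal.coe_ne_top
    rw [e1]
    refine (cakeNorm_sub_le ha (hx.sub hem.aemeasurable) m2.aemeasurable).trans ?_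
    refine (add_le_add he b2).trans (le_of_eq ?_)
    rw [← two_mul, ← mul_div_assoc, mul_comm, show (4 : ℝ≥0∞) = 2 * 2 by norm_num,
      ENNReal.mul_div_mul_right _ _ two_ne_zero ENNReal.ofNat_ne_top]
  · have hy : cakeNorm a leb (fun t => e (digits r t)) ≤ 2 * X := by
      have e2 : (fun t => e (digits r t)) = fun t => x t - (x t - e (digits r t)) := by
        ext t; ring
      rw [e2]
      refine (cakeNorm_sub_le ha hx (hx.sub hem.aemeasurable)).trans ?_
      rw [two_mul]
      refine add_le_add le_rfl (he.trans ?_)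
      exact ENNReal.div_le_of_le_mul (le_mul_of_one_le_right' (by norm_num))
    have hone : ∀ k, cakeNorm a leb (levelFn k (ξ k) f) ≤ ∑ j ∈ Finset.range n,
        if j * m + K0 = k then ‖w‖ₑ * (M * (2 * X)) else 0 := by
      intro k
      rw [hlevel]
      refine (cakeNorm_sum_le ha _ _ fun j => ?_).trans (Finset.sum_le_sum fun j _ => ?_)
      · split_ifs
        · exact ((measurable_levelFn hf _ _).const_mul _).aemeasurable
        · exact aemeasurable_const
      · split_ifs with hjk
        · rw [cakeNorm_const_mul]
          gcongr
          refine (hM _ _).trans ?_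
          gcongr
          have hrk : r ≤ k := hjk ▸ (le_max_left r K).trans (Nat.le_add_left _ _)
          simp_rw [liftCoeff_digits hrk]
          exact hy
        · exact (cakeNorm_eq_zero_of_ae (EventuallyEq.refl _ _)).le
    refine (Finset.sum_le_sum fun k _ => hone k).trans ?_
    rw [Finset.sum_comm]
    have : ∀ j ∈ Finset.range n, (∑ k ∈ Finset.Ico K K',
        if j * m + K0 = k then ‖w‖ₑ * (M * (2 * X)) else 0) = ‖w‖ₑ * (M * (2 * X)) := by
      intro j hj
      rw [Finset.sum_ite_eq, if_pos (hmem j hj)]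
    rw [Finset.sum_congr rfl this, Finset.sum_const, Finset.card_range, nsmul_eq_mul, hw, enorm_mul,
      enorm_inv hn0', Real.enorm_natCast]
    -- There are `n` contributions of weight `1 / n`, so the cost of the block does not depend on
    -- `n`.
    have hnn : (n : ℝ≥0∞) * (n : ℝ≥0∞)⁻¹ = 1 :=
      ENNReal.mul_inv_cancel (by exact_mod_cast hn0) (ENNReal.natCast_ne_top n)
    calc (n : ℝ≥0∞) * (‖I⁻¹‖ₑ * (n : ℝ≥0∞)⁻¹ * (M * (2 * X)))
        = (n : ℝ≥0∞) * (n : ℝ≥0∞)⁻¹ * (2 * M * ‖I⁻¹‖ₑ * X) := by ring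
      _ ≤ _ := by rw [hnn, one_mul]

/-- The residual after subtraction of the levels below `p.1`. -/
def residual (f x : ℝ → ℝ) (p : ℕ × ((k : ℕ) → (Fin k → Bool) → ℝ)) (t : ℝ) : ℝ :=
  x t - ∑ k ∈ Finset.range p.1, levelFn k (p.2 k) f t

theorem aemeasurable_residual (hf : Measurable f) {x : ℝ → ℝ} (hx : AEMeasurable x leb)
    (p : ℕ × ((k : ℕ) → (Fin k → Bool) → ℝ)) : AEMeasurable (residual f x p) leb :=
  hx.sub (Finset.aemeasurable_fun_sum _ fun _ _ => (measurable_levelFn hf _ _).aemeasurable)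

/-- A state `p` records how many levels are fixed and their coefficients. The block is applied to
the residual and placed beyond `p.1`, leaving the earlier coefficients untouched. -/
theorem exists_next (ha : Measurable a) (h0 : mixMin a 1 ≠ 0) (h1 : mixMin a 1 ≠ ∞)
    (hf : Measurable f) (hfin : cakeNorm a leb f ≠ ∞) (hint : ∫ u, f u ∂leb ≠ 0)
    (hM : ∀ (k : ℕ) (c : (Fin k → Bool) → ℝ),
      cakeNorm a leb (levelFn k c f) ≤ M * cakeNorm a leb fun t => c (digits k t))
    {x : ℝ → ℝ} (hx : AEMeasurable x leb) (p : ℕ × ((k : ℕ) → (Fin k → Bool) → ℝ)) :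
    ∃ q : ℕ × ((k : ℕ) → (Fin k → Bool) → ℝ), p.1 < q.1 ∧ (∀ k < p.1, q.2 k = p.2 k) ∧
      cakeNorm a leb (residual f x q) ≤ cakeNorm a leb (residual f x p) / 2 ∧
      ∑ k ∈ Finset.Ico p.1 q.1, cakeNorm a leb (levelFn k (q.2 k) f) ≤
        2 * M * ‖(∫ u, f u ∂leb)⁻¹‖ₑ * cakeNorm a leb (residual f x p) := by
  obtain ⟨K', η, hK, hres, hsum⟩ := exists_block ha h0 h1 hf hfin hint hM
    (aemeasurable_residual hf hx p) p.1
  refine ⟨(K', fun k => if k < p.1 then p.2 k else η k), hK, fun k hk => if_pos hk, ?_, ?_⟩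
  · refine le_of_eq_of_le (congrArg _ ?_) hres
    ext t
    simp only [residual]
    rw [← Finset.sum_range_add_sum_Ico _ hK.le, ← sub_sub]
    congr 1
    · congr 1
      exact Finset.sum_congr rfl fun k hk => by rw [if_pos (Finset.mem_range.1 hk)]
    · exact Finset.sum_congr rfl fun k hk => by
        rw [if_neg (not_lt.2 (Finset.mem_Ico.1 hk).1)]
  · refine le_of_eq_of_le (Finset.sum_congr rfl fun k hk => ?_) hsum
    dsimp only
    rw [if_neg (not_lt.2 (Finset.mem_Ico.1 hk).1)]

theorem exists_levels (ha : Measurable a) (h0 : mixMin a 1 ≠ 0) (h1 : mixMin a 1 ≠ ∞)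
    (hf : Measurable f) (hfin : cakeNorm a leb f ≠ ∞) (hint : ∫ u, f u ∂leb ≠ 0)
    (hM : ∀ (k : ℕ) (c : (Fin k → Bool) → ℝ),
      cakeNorm a leb (levelFn k c f) ≤ M * cakeNorm a leb fun t => c (digits k t))
    {x : ℝ → ℝ} (hx : AEMeasurable x leb) :
    ∃ (K : ℕ → ℕ) (ξ : (k : ℕ) → (Fin k → Bool) → ℝ), StrictMono K ∧
      (∀ i, cakeNorm a leb (residual f x (K i, ξ)) ≤ cakeNorm a leb x / 2 ^ i) ∧
      ∑' k, cakeNorm a leb (levelFn k (ξ k) f) ≤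
        2 * (2 * M * ‖(∫ u, f u ∂leb)⁻¹‖ₑ) * cakeNorm a leb x := by
  set D := 2 * M * ‖(∫ u, f u ∂leb)⁻¹‖ₑ
  choose next hlt hkeep hhalf hsum using
    exists_next (x := x) ha h0 h1 hf hfin hint hM hx
  let st : ℕ → ℕ × ((k : ℕ) → (Fin k → Bool) → ℝ) := fun i => next^[i] (0, fun _ => 0)
  have hst : ∀ i, st (i + 1) = next (st i) := fun i => Function.iterate_succ_apply' _ _ _
  have hmono : StrictMono fun i => (st i).1 := strictMono_nat_of_lt_succ fun i => by
    rw [hst]; exact hlt _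
  have hstable : ∀ i j, i ≤ j → ∀ k < (st i).1, (st j).2 k = (st i).2 k := by
    intro i j hij
    induction j, hij using Nat.le_induction with
    | base => intro k _; rfl
    | succ j hij ih =>
      intro k hk
      rw [hst, hkeep _ k (hk.trans_le (hmono.monotone hij)), ih k hk]
  -- After `k + 1` steps more than `k` levels are fixed, so the coefficients of level `k` are final.
  set ξ : (k : ℕ) → (Fin k → Bool) → ℝ := fun k => (st (k + 1)).2 k with hξ
  have hξeq : ∀ i, ∀ k < (st i).1, (st i).2 k = ξ k := by
    intro i k hk
    have hk' : k < (st (k + 1)).1 := hmono.le_apply (x := k + 1)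
    rcases le_total i (k + 1) with h | h
    · exact (hstable _ _ h k hk).symm
    · exact hstable _ _ h k hk'
  have hres : ∀ i, residual f x ((st i).1, ξ) = residual f x (st i) := by
    intro i; ext t
    simp only [residual]
    congr 1
    exact Finset.sum_congr rfl fun k hk => by rw [hξeq i k (Finset.mem_range.1 hk)]
  have hx0 : cakeNorm a leb (residual f x (st 0)) = cakeNorm a leb x := by
    congr 1; ext t; simp [residual, st]
  refine ⟨fun i => (st i).1, ξ, hmono, fun i => ?_, ?_⟩
  · simp only [hres]
    induction i with
    | zero => simp [hx0]
    | succ i ih =>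
      rw [hst]
      refine (hhalf _).trans ?_
      rw [pow_succ, ENNReal.div_eq_inv_mul, ENNReal.div_eq_inv_mul,
        ENNReal.mul_inv (Or.inr ENNReal.ofNat_ne_top) (Or.inr two_ne_zero), mul_comm (2 ^ i)⁻¹,
        mul_assoc]
      gcongr
      rwa [ENNReal.div_eq_inv_mul] at ih
  -- The spent cost plus `2 D` times the current residual norm never increases: a block costs at
  -- most `D` times the residual norm, and halving that norm releases the same amount.
  · have key : ∀ i, ∑ k ∈ Finset.range (st i).1, cakeNorm a leb (levelFn k (ξ k) f) +
        2 * D * cakeNorm a leb (residual f x (st i)) ≤ 2 * D * cakeNorm a leb x := by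
      intro i
      induction i with
      | zero => rw [hx0]; simp [st]
      | succ i ih =>
        refine le_trans ?_ ih
        rw [← Finset.sum_range_add_sum_Ico _ (hmono.monotone (Nat.le_succ i)), add_assoc]
        gcongr
        have e1 : ∑ k ∈ Finset.Ico (st i).1 (st (i + 1)).1, cakeNorm a leb (levelFn k (ξ k) f) ≤
            D * cakeNorm a leb (residual f x (st i)) := by
          have h := hsum (st i)
          rw [← hst] at h
          refine le_of_eq_of_le (Finset.sum_congr rfl fun k hk => ?_) h
          rw [hξeq (i + 1) k (Finset.mem_Ico.1 hk).2]
        have e2 : 2 * D * cakeNorm a leb (residual f x (st (i + 1))) ≤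
            D * cakeNorm a leb (residual f x (st i)) := by
          rw [hst]
          calc 2 * D * cakeNorm a leb (residual f x (next (st i)))
              ≤ 2 * D * (cakeNorm a leb (residual f x (st i)) / 2) := by gcongr; exact hhalf _
            _ = D * (2 * (cakeNorm a leb (residual f x (st i)) / 2)) := by ring
            _ = _ := by rw [ENNReal.mul_div_cancel two_ne_zero ENNReal.ofNat_ne_top]
        refine (add_le_add e1 e2).trans (le_of_eq ?_)
        ring
    refine ENNReal.tsum_le_of_sum_range_le fun n => ?_
    refine le_trans ?_ (key n)
    refine le_trans ?_ le_self_add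
    exact Finset.sum_le_sum_of_subset (Finset.range_mono (hmono.le_apply (x := n)))

theorem sum_lists_eq {s : Finset (List Bool)} {L : ℕ} (hL : ∀ α ∈ s, α.length < L)
    (F : List Bool → ℝ) : ∑ α ∈ s, F α = ∑ k ∈ Finset.range L, ∑ α : Fin k → Bool,
      if List.ofFn α ∈ s then F (List.ofFn α) else 0 := by
  classical
  rw [Finset.sum_sigma', ← Finset.sum_filter]
  refine Finset.sum_bij' (fun l _ => (List.equivSigmaTuple l : Σ k, Fin k → Bool))
    (fun p _ => List.ofFn p.2) ?_ ?_ ?_ ?_ ?_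
  · intro l hl
    simp only [Finset.mem_filter, Finset.mem_sigma, Finset.mem_range, Finset.mem_univ, and_true]
    exact ⟨hL l hl, by simpa [List.equivSigmaTuple] using hl⟩
  · intro p hp
    exact (Finset.mem_filter.1 hp).2
  · intro l _
    exact List.equivSigmaTuple.symm_apply_apply l
  · intro p _
    exact List.equivSigmaTuple.apply_symm_apply p
  · intro l _
    simp [List.equivSigmaTuple]

/-- For unconditional convergence, a finite set containing all words shorter than `N = K i` leaves
the residual at stage `i` minus parts of levels beyond `N`. Deleting coefficients within a level
only decreases its absolute value pointwise, so these parts are bounded by the tail of a convergent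
series of level norms. -/
theorem exists_representation (ha : Measurable a) (h0 : mixMin a 1 ≠ 0) (h1 : mixMin a 1 ≠ ∞)
    {f₀ : ℝ → ℝ} (hff : f₀ =ᵐ[leb] f)
    (hf : Measurable f) (hfin : cakeNorm a leb f ≠ ∞) (hint : ∫ u, f u ∂leb ≠ 0) (hMtop : M ≠ ∞)
    (hM : ∀ (k : ℕ) (c : (Fin k → Bool) → ℝ),
      cakeNorm a leb (levelFn k c f) ≤ M * cakeNorm a leb fun t => c (digits k t))
    {x : ℝ → ℝ} (hx : AEMeasurable x leb) (hxfin : cakeNorm a leb x ≠ ∞) :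
    ∃ ξ : List Bool → ℝ,
      Tendsto (fun s : Finset (List Bool) =>
        cakeNorm a leb (fun t => x t - ∑ α ∈ s, ξ α * Vpow α f₀ t)) atTop (𝓝 0) ∧
      ∑' k : ℕ, cakeNorm a leb
          (fun t => ∑ α : Fin k → Bool, ξ (List.ofFn α) * Vpow (List.ofFn α) f₀ t) ≤
        2 * (2 * M * ‖(∫ u, f u ∂leb)⁻¹‖ₑ) * cakeNorm a leb x := by
  classical
  obtain ⟨K, ξ, hK, hres, hsum⟩ := exists_levels ha h0 h1 hf hfin hint hM hx
  have hsumfin : ∑' k, cakeNorm a leb (levelFn k (ξ k) f) ≠ ∞ :=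
    ne_top_of_le_ne_top (by finiteness) hsum
  have hξ : ∀ (k : ℕ) (α : Fin k → Bool), (fun l : List Bool => ξ (List.equivSigmaTuple l).1
      (List.equivSigmaTuple l).2) (List.ofFn α) = ξ k α := by
    intro k α
    have h := List.equivSigmaTuple.apply_symm_apply (⟨k, α⟩ : Σ k, Fin k → Bool)
    have h2 : (List.equivSigmaTuple (List.ofFn α) : Σ k, Fin k → Bool) = ⟨k, α⟩ := h
    exact congrArg (fun p : Σ k, Fin k → Bool => ξ p.1 p.2) h2
  refine ⟨fun l => ξ (List.equivSigmaTuple l).1 (List.equivSigmaTuple l).2, ?_, ?_⟩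
  swap
  · refine le_of_eq_of_le (tsum_congr fun k => ?_) hsum
    refine cakeNorm_congr_ae (EventuallyEq.trans ?_ (sum_Vpow_ae hff k (ξ k)))
    exact Eventually.of_forall fun t => Finset.sum_congr rfl fun α _ => by rw [← hξ k α]
  set ζ : List Bool → ℝ := fun l => ξ (List.equivSigmaTuple l).1 (List.equivSigmaTuple l).2 with hζ
  rw [ENNReal.tendsto_nhds_zero]
  intro η hη
  have hη2 : 0 < η / 2 := ENNReal.half_pos hη.ne'
  have htail : Tendsto (fun n => ∑' k, cakeNorm a leb (levelFn (k + n) (ξ (k + n)) f)) atTop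
      (𝓝 0) := ENNReal.tendsto_sum_nat_add (fun k => cakeNorm a leb (levelFn k (ξ k) f)) hsumfin
  have hgeo : Tendsto (fun i : ℕ => cakeNorm a leb x / 2 ^ i) atTop (𝓝 0) := by
    have h := ENNReal.tendsto_pow_atTop_nhds_zero_of_lt_one (r := 2⁻¹) (by simp)
    have h2 := ENNReal.Tendsto.const_mul (a := cakeNorm a leb x) h (Or.inr hxfin)
    simpa [div_eq_mul_inv, ENNReal.inv_pow] using h2
  obtain ⟨i, hi1, hi2⟩ := ((hgeo.eventually (Iic_mem_nhds hη2)).and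
    ((htail.comp hK.tendsto_atTop).eventually (Iic_mem_nhds hη2))).exists
  set N := K i with hN
  set s₀ : Finset (List Bool) := (Finset.range N).biUnion fun k =>
    (Finset.univ : Finset (Fin k → Bool)).image List.ofFn with hs₀
  filter_upwards [eventually_ge_atTop s₀] with s hs
  obtain ⟨L, hL⟩ : ∃ L, ∀ α ∈ s, α.length < L := by
    refine ⟨s.sup List.length + 1, fun α hα => Nat.lt_succ_of_le ?_⟩
    exact Finset.le_sup (f := List.length) hα
  set L' := max N L with hL'
  have hsL : ∀ α ∈ s, α.length < L' := fun α hα => (hL α hα).trans_le (le_max_right _ _)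
  -- The level coefficients restricted to `s`; below `N` nothing is lost.
  set θ : (k : ℕ) → (Fin k → Bool) → ℝ := fun k α => if List.ofFn α ∈ s then ξ k α else 0 with hθ
  have hθlow : ∀ k < N, θ k = ξ k := by
    intro k hk
    ext α
    rw [hθ]
    simp only
    rw [if_pos (hs ?_)]
    rw [hs₀, Finset.mem_biUnion]
    exact ⟨k, Finset.mem_range.2 hk, Finset.mem_image_of_mem _ (Finset.mem_univ _)⟩
  have hae : (fun t => x t - ∑ α ∈ s, ζ α * Vpow α f₀ t) =ᵐ[leb] fun t =>
      residual f x (N, ξ) t - ∑ k ∈ Finset.Ico N L', levelFn k (θ k) f t := by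
    filter_upwards [ae_all_iff.2 fun k => sum_Vpow_ae hff k (θ k)] with t ht
    rw [sum_lists_eq hsL fun α => ζ α * Vpow α f₀ t]
    have h2 : ∀ k, (∑ α : Fin k → Bool, if List.ofFn α ∈ s then
        ζ (List.ofFn α) * Vpow (List.ofFn α) f₀ t else 0) = levelFn k (θ k) f t := by
      intro k
      rw [← ht k]
      refine Finset.sum_congr rfl fun α _ => ?_
      rw [hθ]
      simp only
      rw [← hξ k α]
      split_ifs <;> simp [hζ]
    simp_rw [h2]
    rw [residual, ← Finset.sum_range_add_sum_Ico _ (le_max_left N L), ← sub_sub]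
    congr 2
    exact Finset.sum_congr rfl fun k hk => by rw [hθlow k (Finset.mem_range.1 hk)]
  rw [cakeNorm_congr_ae hae]
  refine (cakeNorm_sub_le ha (aemeasurable_residual hf hx _)
    (Finset.measurable_fun_sum _ fun k _ => measurable_levelFn hf k (θ k)).aemeasurable).trans ?_
  rw [← ENNReal.add_halves η]
  refine add_le_add ((hres i).trans hi1) ?_
  calc cakeNorm a leb (fun t => ∑ k ∈ Finset.Ico N L', levelFn k (θ k) f t)
      ≤ ∑ k ∈ Finset.Ico N L', cakeNorm a leb (levelFn k (θ k) f) :=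
        cakeNorm_sum_le ha _ _ fun k => (measurable_levelFn hf k (θ k)).aemeasurable
    _ ≤ ∑ k ∈ Finset.Ico N L', cakeNorm a leb (levelFn k (ξ k) f) := by
        refine Finset.sum_le_sum fun k _ => cakeNorm_mono_ae (Eventually.of_forall fun t => ?_)
        simp only [levelFn, enorm_mul]
        gcongr
        rw [hθ]
        simp only
        split_ifs <;> simp
    _ ≤ ∑' k, cakeNorm a leb (levelFn (k + N) (ξ (k + N)) f) := by
        rw [Finset.sum_Ico_eq_sum_range]
        rw [Finset.sum_congr rfl fun k _ => by rw [add_comm N k]]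
        exact ENNReal.sum_le_tsum _
    _ ≤ η / 2 := hi2

end Representing

/-! ### Necessity: testing on indicators of the last dyadic intervals -/

section Necessity

variable {a : ℝ → ℝ≥0∞} {f : ℝ → ℝ}

theorem distr_smul {Ω : Type*} [MeasurableSpace Ω] (w : ℝ≥0∞) (ν : Measure Ω) (x : Ω → ℝ) (s : ℝ) :
    distr (w • ν) x s = w * distr ν x s := by simp [distr]

theorem cakeNorm_smul_mono {v w : ℝ≥0∞} (h : v ≤ w) :
    cakeNorm a (v • leb) f ≤ cakeNorm a (w • leb) f :=
  lintegral_mono fun s => mixMin_mono (by rw [distr_smul, distr_smul]; gcongr)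

/-- The last dyadic interval of rank `n`. -/
def lastInterval (n : ℕ) : Set ℝ := {t | digits n t = fun _ => true}

theorem measurableSet_lastInterval (n : ℕ) : MeasurableSet (lastInterval n) :=
  measurable_digits n (measurableSet_singleton _)

theorem digits_add_eq (k d : ℕ) (t : ℝ) : (digits (k + d) t = fun _ => true) ↔
    (digits k t = fun _ => true) ∧ digits d (dbl^[k] t) = fun _ => true := by
  induction k generalizing t with
  | zero =>
    rw [Nat.zero_add]
    simp only [Function.iterate_zero, id_eq, iff_and_self]
    intro _
    exact Subsingleton.elim _ _
  | succ k ih =>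
    have cons_eq : ∀ (m : ℕ) (b : Bool) (β : Fin m → Bool),
        ((Fin.cons b β : Fin (m + 1) → Bool) = fun _ => true) ↔ b = true ∧ β = fun _ => true := by
      intro m b β
      constructor
      · intro h
        refine ⟨by simpa using congrFun h 0, ?_⟩
        ext i
        simpa using congrFun h i.succ
      · rintro ⟨rfl, rfl⟩
        ext i
        refine Fin.cases rfl (fun i => rfl) i
    have e : ∀ m n : ℕ, m = n → ((digits m t = fun _ => true) ↔ digits n t = fun _ => true) := by
      rintro m _ rfl
      rfl
    rw [e (k + 1 + d) (k + d + 1) (by ring), digits_succ, digits_succ, cons_eq, cons_eq, ih,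
      Function.iterate_succ_apply, and_assoc]

theorem leb_lastInterval (n : ℕ) : leb (lastInterval n) = (2 ^ n)⁻¹ := by
  classical
  have h := leb_digits_inter n (fun α => if α = fun _ => true then univ else ∅) fun α => by
    split_ifs <;> simp
  have e : lastInterval n = {t | dbl^[n] t ∈
      if digits n t = fun _ => true then (univ : Set ℝ) else ∅} := by
    ext t
    by_cases h : digits n t = fun _ => true <;> simp [lastInterval, h]
  rw [e, h]
  have e2 : ∀ α : Fin n → Bool, leb (if α = fun _ => true then univ else ∅) =
      if α = fun _ => true then 1 else 0 := fun α => by split_ifs <;> simp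
  simp_rw [e2]
  simp

theorem mem_lastInterval_iff (n : ℕ) : ∀ t ∈ Ico (0 : ℝ) 1,
    (t ∈ lastInterval n ↔ 1 - (1 / 2) ^ n ≤ t) := by
  induction n with
  | zero =>
    intro t ht
    refine ⟨fun _ => by simpa using ht.1, fun _ => Subsingleton.elim _ _⟩
  | succ n ih =>
    intro t ht
    have h : t ∈ lastInterval (n + 1) ↔ digit t = true ∧ dbl t ∈ lastInterval n := by
      have := digits_add_eq 1 n t
      have h1 : (digits 1 t = fun _ => true) ↔ digit t = true := by
        simp [funext_iff, digits]
      rw [h1] at this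
      rw [lastInterval, add_comm]
      exact this
    rw [h]
    by_cases h12 : 1 / 2 ≤ t
    · have hs : dbl t = 2 * t - 1 := by
        rw [dbl, ← Int.fract_sub_one]
        exact Int.fract_eq_self.2 ⟨by linarith, by linarith [ht.2]⟩
      have hd : digit t = true := by simpa [digit] using h12
      rw [ih (dbl t) ⟨Int.fract_nonneg _, Int.fract_lt_one _⟩, hs, pow_succ]
      constructor
      · intro h; linarith [h.2]
      · intro h; exact ⟨hd, by linarith⟩
    · have hd : digit t ≠ true := by simpa [digit] using h12
      refine ⟨fun h => absurd h.1 hd, fun h => absurd ?_ h12⟩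
      have : (1 / 2 : ℝ) ^ n ≤ 1 := pow_le_one₀ (by norm_num) (by norm_num)
      rw [pow_succ] at h
      linarith

theorem rearrangement_lt_top (hf : AEMeasurable f leb) {t : ℝ} (ht : 0 < t) :
    rearrangement leb f t < ∞ := by
  obtain ⟨n, hn⟩ := ((tendsto_distr_atTop hf).eventually
    (Iic_mem_nhds (ENNReal.ofReal_pos.2 ht))).exists
  exact (sInf_le (show ENNReal.ofReal n ∈ _ from hn)).trans_lt ENNReal.ofReal_lt_top

/-- The average of a decreasing function over the last dyadic interval is at most its mean. -/
theorem setLIntegral_lastInterval_le (hf : AEMeasurable f leb)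
    (hdecr : ∀ᵐ t ∂leb, f t = (rearrangement leb f t).toReal) (d : ℕ) :
    ∫⁻ t in lastInterval d, ‖f t‖ₑ ∂leb ≤ (2 ^ d)⁻¹ * ∫⁻ t, ‖f t‖ₑ ∂leb := by
  rcases d.eq_zero_or_pos with rfl | hd
  · simpa using setLIntegral_le_lintegral _ _
  set A := lastInterval d with hA
  have hAm : MeasurableSet A := measurableSet_lastInterval d
  set p : ℝ := 1 - (1 / 2) ^ d with hp
  have hp0 : 0 < p := by
    have : (1 / 2 : ℝ) ^ d < 1 := pow_lt_one₀ (by norm_num) (by norm_num) hd.ne'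
    rw [hp]; linarith
  -- `G` is the value at the left endpoint of `A`: almost everywhere `f ≤ G` on `A` and `f ≥ G` off
  -- it, which compares the averages.
  set G : ℝ≥0∞ := rearrangement leb f p with hG
  have hI : ∀ᵐ t ∂leb, t ∈ Ico (0 : ℝ) 1 := by
    rw [leb_eq]; exact ae_restrict_mem measurableSet_Ico
  have hne : ∀ᵐ t ∂leb, t ≠ 0 := by
    rw [leb]; exact ae_restrict_of_ae (Measure.ae_ne volume _)
  have hval : ∀ᵐ t ∂leb, ‖f t‖ₑ = rearrangement leb f t := by
    filter_upwards [hI, hne, hdecr] with t ht ht0 hft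
    have hpos : 0 < t := lt_of_le_of_ne ht.1 (Ne.symm ht0)
    rw [hft, Real.enorm_of_nonneg ENNReal.toReal_nonneg,
      ENNReal.ofReal_toReal (rearrangement_lt_top hf hpos).ne]
  have h1 : ∫⁻ t in A, ‖f t‖ₑ ∂leb ≤ leb A * G := by
    rw [mul_comm, ← setLIntegral_const]
    refine lintegral_mono_ae ((ae_restrict_iff' hAm).2 ?_)
    filter_upwards [hI, hval] with t ht hft hmem
    rw [hft]
    exact rearrangement_antitone ((mem_lastInterval_iff d t ht).1 hmem)
  have h2 : leb Aᶜ * G ≤ ∫⁻ t in Aᶜ, ‖f t‖ₑ ∂leb := by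
    rw [mul_comm, ← setLIntegral_const]
    refine lintegral_mono_ae ((ae_restrict_iff' hAm.compl).2 ?_)
    filter_upwards [hI, hval] with t ht hft hmem
    rw [hft]
    refine rearrangement_antitone (le_of_not_ge fun h => hmem ?_)
    exact (mem_lastInterval_iff d t ht).2 h
  rw [← leb_lastInterval]
  calc ∫⁻ t in A, ‖f t‖ₑ ∂leb = (leb A + leb Aᶜ) * ∫⁻ t in A, ‖f t‖ₑ ∂leb := by
        rw [measure_add_measure_compl hAm, measure_univ, one_mul]
    _ = leb A * (∫⁻ t in A, ‖f t‖ₑ ∂leb) + leb Aᶜ * ∫⁻ t in A, ‖f t‖ₑ ∂leb := add_mul _ _ _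
    _ ≤ leb A * (∫⁻ t in A, ‖f t‖ₑ ∂leb) + leb A * ∫⁻ t in Aᶜ, ‖f t‖ₑ ∂leb := by
        refine add_le_add_right ?_ _
        calc leb Aᶜ * ∫⁻ t in A, ‖f t‖ₑ ∂leb ≤ leb Aᶜ * (leb A * G) := by gcongr
          _ = leb A * (leb Aᶜ * G) := by ring
          _ ≤ _ := by gcongr
    _ = leb A * ∫⁻ t, ‖f t‖ₑ ∂leb := by rw [← mul_add, lintegral_add_compl _ hAm]

theorem setLIntegral_levelFn (hf : Measurable f) {k : ℕ} (c : (Fin k → Bool) → ℝ)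
    (P : (Fin k → Bool) → Set ℝ) (hP : ∀ α, MeasurableSet (P α)) {A : Set ℝ} (hA : MeasurableSet A)
    (hAP : ∀ t, t ∈ A ↔ dbl^[k] t ∈ P (digits k t)) :
    ∫⁻ t in A, ‖levelFn k c f t‖ₑ ∂leb =
      (2 ^ k)⁻¹ * ∑ α, ‖c α‖ₑ * ∫⁻ u in P α, ‖f u‖ₑ ∂leb := by
  rw [← lintegral_indicator hA]
  have h := lintegral_digits k (G := fun α => (P α).indicator fun u => ‖c α‖ₑ * ‖f u‖ₑ)
    fun α => (hf.enorm.const_mul _).indicator (hP α)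
  have e : ∀ α, ∫⁻ u, (P α).indicator (fun u => ‖c α‖ₑ * ‖f u‖ₑ) u ∂leb =
      ‖c α‖ₑ * ∫⁻ u in P α, ‖f u‖ₑ ∂leb := fun α => by
    rw [lintegral_indicator (hP α), lintegral_const_mul _ hf.enorm]
  simp_rw [e] at h
  rw [← h]
  refine lintegral_congr fun t => ?_
  by_cases ht : t ∈ A
  · rw [indicator_of_mem ht, indicator_of_mem ((hAP t).1 ht), levelFn, enorm_mul]
  · rw [indicator_of_notMem ht, indicator_of_notMem fun h => ht ((hAP t).2 h)]

/-- The last interval of rank `k + d` meets a single interval of rank `k`, where the level function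
is a rescaled multiple of `f`; the bound for `f` on `lastInterval d` is therefore inherited. -/
theorem setLIntegral_levelFn_lastInterval_le (hf : Measurable f)
    (hdecr : ∀ᵐ t ∂leb, f t = (rearrangement leb f t).toReal) (k d : ℕ)
    (c : (Fin k → Bool) → ℝ) :
    ∫⁻ t in lastInterval (k + d), ‖levelFn k c f t‖ₑ ∂leb ≤
      (2 ^ d)⁻¹ * ∫⁻ t in lastInterval k, ‖levelFn k c f t‖ₑ ∂leb := by
  classical
  rw [setLIntegral_levelFn hf c (fun α => if α = fun _ => true then lastInterval d else ∅) (fun α => by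
      split_ifs <;> simp [measurableSet_lastInterval]) (measurableSet_lastInterval _),
    setLIntegral_levelFn hf c (fun α => if α = fun _ => true then univ else ∅) (fun α => by
      split_ifs <;> simp) (measurableSet_lastInterval _)]
  · rw [mul_left_comm, Finset.mul_sum (a := (2 ^ d)⁻¹)]
    refine mul_le_mul_right (Finset.sum_le_sum fun α _ => ?_) _
    split_ifs
    · rw [mul_left_comm, Measure.restrict_univ]
      gcongr
      exact setLIntegral_lastInterval_le hf.aemeasurable hdecr d
    · simp
  · intro t
    by_cases h : digits k t = fun _ => true <;> simp [lastInterval, h]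
  · intro t
    rw [lastInterval, mem_ofPred_eq, digits_add_eq]
    by_cases h : digits k t = fun _ => true <;> simp [lastInterval, h]

/-- Both sides are compared with `∑ |c α|` over the intervals inside `lastInterval j`. The integral
equals `2⁻ᵏ ‖f‖₁` times this sum. By concavity of `φ`, the norm of the level is at least `2^(j-k)`
times the sum, multiplied by the norm of `f` under `2⁻ʲ • leb`. -/
theorem cakeNorm_mul_setLIntegral_le (ha : Measurable a) (hf : Measurable f) {j k : ℕ}
    (hjk : j ≤ k) (c : (Fin k → Bool) → ℝ) :
    cakeNorm a ((2 ^ j : ℝ≥0∞)⁻¹ • leb) f *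
        ∫⁻ t in lastInterval j, ‖levelFn k c f t‖ₑ ∂leb ≤
      (∫⁻ u, ‖f u‖ₑ ∂leb) * (2 ^ j)⁻¹ * cakeNorm a leb (levelFn k c f) := by
  classical
  set P : Finset (Fin k → Bool) := {α | ∀ i : Fin j, α (Fin.castLE hjk i) = true}
    with hP
  have hmem : ∀ t, t ∈ lastInterval j ↔ digits k t ∈ P := by
    intro t
    rw [hP, Finset.mem_filter, lastInterval, mem_ofPred_eq, funext_iff]
    simp [digits]
  have hAP : ∀ t, t ∈ lastInterval j ↔ dbl^[k] t ∈
      (fun α => if α ∈ P then (univ : Set ℝ) else ∅) (digits k t) := by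
    intro t
    rw [hmem]
    by_cases h : digits k t ∈ P <;> simp [h]
  have hPm : ∀ α : Fin k → Bool, MeasurableSet (if α ∈ P then (univ : Set ℝ) else ∅) := fun α => by
    split_ifs <;> simp
  set F := ∫⁻ u, ‖f u‖ₑ ∂leb with hF
  set ψ := cakeNorm a ((2 ^ j : ℝ≥0∞)⁻¹ • leb) f with hψ
  have hcard : (2 ^ k : ℝ≥0∞)⁻¹ * (P.card : ℝ≥0∞) = (2 ^ j)⁻¹ := by
    have h := leb_digits_inter k (fun α => if α ∈ P then (univ : Set ℝ) else ∅) hPm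
    have e : {t | dbl^[k] t ∈ (fun α => if α ∈ P then (univ : Set ℝ) else ∅) (digits k t)} =
        lastInterval j := by
      ext t; exact (hAP t).symm
    have e2 : ∀ α : Fin k → Bool, leb (if α ∈ P then univ else ∅) = if α ∈ P then 1 else 0 :=
      fun α => by split_ifs <;> simp
    rw [e, leb_lastInterval] at h
    simp_rw [e2] at h
    rw [h]
    simp
  have hj0 : (2 ^ j : ℝ≥0∞) ≠ 0 := by positivity
  have hjt : (2 ^ j : ℝ≥0∞) ≠ ∞ := by finiteness
  have hcancel : (2 ^ j : ℝ≥0∞) * (2 ^ j)⁻¹ = 1 := ENNReal.mul_inv_cancel hj0 hjt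
  have hint : ∫⁻ t in lastInterval j, ‖levelFn k c f t‖ₑ ∂leb =
      (2 ^ k)⁻¹ * ∑ α ∈ P, ‖c α‖ₑ * F := by
    rw [setLIntegral_levelFn hf c _ hPm (measurableSet_lastInterval j) hAP]
    congr 1
    rw [← Finset.sum_filter_add_sum_filter_not Finset.univ (fun α => α ∈ P)]
    rw [Finset.sum_eq_zero (s := Finset.univ.filter fun α => α ∉ P), add_zero]
    · have : Finset.univ.filter (fun α => α ∈ P) = P := by ext; simp
      rw [this]
      exact Finset.sum_congr rfl fun α hα => by rw [if_pos hα, Measure.restrict_univ]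
    · intro α hα
      rw [if_neg (Finset.mem_filter.1 hα).2]
      simp
  -- Jensen with weight `2^(j-k)` on each of the `2^(k-j)` words of `P`, so the total weight is
  -- exactly one; the other words are discarded by monotonicity.
  have hnorm : ∑ α ∈ P, (2 ^ j * (2 ^ k)⁻¹) * (‖c α‖ₑ * ψ) ≤ cakeNorm a leb (levelFn k c f) := by
    have hψc : ∀ α, ‖c α‖ₑ * ψ = ∫⁻ s in Ioi (0 : ℝ),
        mixMin a ((2 ^ j)⁻¹ * distr leb (fun u => c α * f u) s) := fun α => by
      rw [hψ, ← cakeNorm_const_mul, cakeNorm]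
      simp_rw [distr_smul]
    have hmeas : ∀ α, Measurable fun s =>
        mixMin a ((2 ^ j)⁻¹ * distr leb (fun u => c α * f u) s) := fun α =>
      measurable_mixMin.comp (measurable_distr.const_mul _)
    simp_rw [hψc, ← lintegral_const_mul _ (hmeas _)]
    rw [← lintegral_finsetSum _ fun α _ => (hmeas α).const_mul _]
    refine lintegral_mono fun s => ?_
    refine (sum_mul_mixMin_le ha P (fun _ => 2 ^ j * (2 ^ k)⁻¹)
      (fun α => (2 ^ j)⁻¹ * distr leb (fun u => c α * f u) s) ?_).trans (mixMin_mono ?_)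
    · rw [Finset.sum_const, nsmul_eq_mul, mul_comm, mul_assoc, hcard, hcancel]
    · rw [distr_levelFn hf, Finset.mul_sum]
      refine le_trans (Finset.sum_le_sum fun α _ => ?_)
        (Finset.sum_le_sum_of_subset (Finset.subset_univ P))
      calc 2 ^ j * (2 ^ k)⁻¹ * ((2 ^ j)⁻¹ * distr leb (fun u => c α * f u) s)
          = (2 ^ j * (2 ^ j)⁻¹) * ((2 ^ k)⁻¹ * distr leb (fun u => c α * f u) s) := by ring
        _ ≤ _ := by rw [hcancel, one_mul]
  calc ψ * ∫⁻ t in lastInterval j, ‖levelFn k c f t‖ₑ ∂leb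
      = (2 ^ j * (2 ^ j)⁻¹) * (ψ * ((2 ^ k)⁻¹ * ∑ α ∈ P, ‖c α‖ₑ * F)) := by
        rw [hint, hcancel, one_mul]
    _ = F * (2 ^ j)⁻¹ * ∑ α ∈ P, (2 ^ j * (2 ^ k)⁻¹) * (‖c α‖ₑ * ψ) := by
        simp_rw [Finset.mul_sum]
        exact Finset.sum_congr rfl fun α _ => by ring
    _ ≤ _ := by gcongr

/-- Levels `k ≥ n` are covered by concavity. For `n = k + d`, passing to the smaller interval gains
a factor `2⁻ᵈ` because `f` is decreasing, and the case of rank `k` supplies the remaining `2⁻ᵏ`. -/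
theorem cakeNorm_mul_setLIntegral_levelFn_le (ha : Measurable a) (hf : Measurable f)
    (hdecr : ∀ᵐ t ∂leb, f t = (rearrangement leb f t).toReal) (n k : ℕ)
    (c : (Fin k → Bool) → ℝ) :
    cakeNorm a ((2 ^ n : ℝ≥0∞)⁻¹ • leb) f *
        ∫⁻ t in lastInterval n, ‖levelFn k c f t‖ₑ ∂leb ≤
      (∫⁻ u, ‖f u‖ₑ ∂leb) * (2 ^ n)⁻¹ * cakeNorm a leb (levelFn k c f) := by
  rcases le_total n k with h | h
  · exact cakeNorm_mul_setLIntegral_le ha hf h c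
  · obtain ⟨d, rfl⟩ := Nat.exists_eq_add_of_le h
    have hpow : (2 ^ (k + d) : ℝ≥0∞)⁻¹ = (2 ^ k)⁻¹ * (2 ^ d)⁻¹ := by
      rw [pow_add, ENNReal.mul_inv (Or.inl (by positivity)) (Or.inl (by finiteness))]
    have hle : (2 ^ (k + d) : ℝ≥0∞)⁻¹ ≤ (2 ^ k)⁻¹ :=
      ENNReal.inv_le_inv.2 (pow_le_pow_right₀ one_le_two (Nat.le_add_right k d))
    calc cakeNorm a ((2 ^ (k + d) : ℝ≥0∞)⁻¹ • leb) f *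
          ∫⁻ t in lastInterval (k + d), ‖levelFn k c f t‖ₑ ∂leb
        ≤ cakeNorm a ((2 ^ k : ℝ≥0∞)⁻¹ • leb) f *
          ((2 ^ d)⁻¹ * ∫⁻ t in lastInterval k, ‖levelFn k c f t‖ₑ ∂leb) :=
          mul_le_mul' (cakeNorm_smul_mono hle) (setLIntegral_levelFn_lastInterval_le hf hdecr k d c)
      _ = (2 ^ d)⁻¹ * (cakeNorm a ((2 ^ k : ℝ≥0∞)⁻¹ • leb) f *
          ∫⁻ t in lastInterval k, ‖levelFn k c f t‖ₑ ∂leb) := by ring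
      _ ≤ (2 ^ d)⁻¹ * ((∫⁻ u, ‖f u‖ₑ ∂leb) * (2 ^ k)⁻¹ * cakeNorm a leb (levelFn k c f)) := by
          exact mul_le_mul_right (cakeNorm_mul_setLIntegral_le ha hf le_rfl c) _
      _ = _ := by rw [hpow]; ring

theorem cakeNorm_indicator_le {Ω : Type*} [MeasurableSpace Ω] {ν : Measure Ω} (A : Set Ω) :
    cakeNorm a ν (A.indicator 1) ≤ mixMin a (ν A) := by
  calc cakeNorm a ν (A.indicator 1)
      ≤ ∫⁻ s in Ioi (0 : ℝ), (Ioc 0 1).indicator (fun _ => mixMin a (ν A)) s := by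
        refine setLIntegral_mono' measurableSet_Ioi fun s hs => ?_
        have hs0 : (0 : ℝ) < s := hs
        by_cases h : s ≤ 1
        · rw [indicator_of_mem (show s ∈ Ioc (0 : ℝ) 1 from ⟨hs0, h⟩)]
          refine mixMin_mono (measure_mono fun u hu => ?_)
          by_contra hA
          rw [mem_ofPred_eq, indicator_of_notMem hA] at hu
          simp at hu
        · have : distr ν (A.indicator 1) s = 0 := by
            refine measure_mono_null (t := ∅) (fun u hu => ?_) measure_empty
            rw [mem_ofPred_eq, ofReal_lt_enorm hs0.le] at hu
            refine absurd hu (not_lt.2 (le_trans ?_ (le_of_not_ge h)))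
            by_cases hA : u ∈ A <;> simp [hA]
          simp [this, mixMin_zero]
    _ ≤ ∫⁻ s, (Ioc (0 : ℝ) 1).indicator (fun _ => mixMin a (ν A)) s := setLIntegral_le_lintegral _ _
    _ = mixMin a (ν A) := by rw [lintegral_indicator measurableSet_Ioc]; simp

/-- The finite set of all words of length less than `K`. -/
def wordsBelow (K : ℕ) : Finset (List Bool) := by
  classical
  exact (Finset.range K).biUnion fun k => (Finset.univ : Finset (Fin k → Bool)).image List.ofFn

theorem mem_wordsBelow {K : ℕ} {l : List Bool} : l ∈ wordsBelow K ↔ l.length < K := by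
  simp only [wordsBelow, Finset.mem_biUnion, Finset.mem_range, Finset.mem_image, Finset.mem_univ,
    true_and]
  constructor
  · rintro ⟨k, hk, α, rfl⟩
    simpa using hk
  · intro h
    exact ⟨_, h, l.get, List.ofFn_get l⟩

theorem tendsto_wordsBelow : Tendsto wordsBelow atTop atTop :=
  tendsto_atTop_finset_of_monotone
    (fun _ _ h _ hl => mem_wordsBelow.2 ((mem_wordsBelow.1 hl).trans_le h))
    fun l => ⟨l.length + 1, mem_wordsBelow.2 (Nat.lt_succ_self _)⟩

/-- Expand the indicator of `A = lastInterval n`, integrate over `A`, multiply by `ψ`, and bound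
each level separately. The sum of the level norms is at most `C φ(h)`, and the factor `h = |A|`
cancels. -/
theorem cakeNorm_dyadic_le_of_representing (ha : Measurable a) (h0 : mixMin a 1 ≠ 0)
    {f₀ : ℝ → ℝ} (hff : f₀ =ᵐ[leb] f)
    (h1 : mixMin a 1 ≠ ∞) (hf : Measurable f) (hfin : cakeNorm a leb f ≠ ∞)
    (hdecr : ∀ᵐ t ∂leb, f t = (rearrangement leb f t).toReal) {C : ℝ≥0∞} (n : ℕ)
    (hC : ∀ x : ℝ → ℝ, AEStronglyMeasurable x leb → cakeNorm a leb x ≠ ∞ → ∃ ξ : List Bool → ℝ,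
      Tendsto (fun s : Finset (List Bool) =>
        cakeNorm a leb (fun t => x t - ∑ α ∈ s, ξ α * Vpow α f₀ t)) atTop (𝓝 0) ∧
      ∑' k : ℕ, cakeNorm a leb
          (fun t => ∑ α : Fin k → Bool, ξ (List.ofFn α) * Vpow (List.ofFn α) f₀ t) ≤
        C * cakeNorm a leb x) :
    cakeNorm a ((2 ^ n : ℝ≥0∞)⁻¹ • leb) f ≤
      (∫⁻ u, ‖f u‖ₑ ∂leb) * C * mixMin a (2 ^ n)⁻¹ := by
  set h : ℝ≥0∞ := (2 ^ n)⁻¹ with hh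
  have hh0 : h ≠ 0 := ENNReal.inv_ne_zero.2 (by finiteness)
  have hht : h ≠ ∞ := ENNReal.inv_ne_top.2 (by positivity)
  have hh1 : h ≤ 1 := by
    rw [hh, ← leb_lastInterval]; exact prob_le_one
  set A := lastInterval n with hA
  have hAm : MeasurableSet A := measurableSet_lastInterval n
  set x : ℝ → ℝ := A.indicator 1 with hx
  have hxm : Measurable x := measurable_one.indicator hAm
  have hNx : cakeNorm a leb x ≤ mixMin a h := by
    refine (cakeNorm_indicator_le A).trans_eq ?_
    rw [hA, leb_lastInterval]
  have hNxfin : cakeNorm a leb x ≠ ∞ :=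
    ne_top_of_le_ne_top h1 (hNx.trans (mixMin_mono hh1))
  obtain ⟨ξ, hlim, hsum⟩ := hC x hxm.aestronglyMeasurable hNxfin
  set ψ := cakeNorm a (h • leb) f with hψ
  set F := ∫⁻ u, ‖f u‖ₑ ∂leb with hF
  have hψfin : ψ ≠ ∞ := by
    refine ne_top_of_le_ne_top hfin ?_
    have := cakeNorm_smul_mono (a := a) (f := f) hh1
    rwa [one_smul] at this
  set L : ℕ → ℝ → ℝ := fun k => levelFn k (fun α => ξ (List.ofFn α)) f with hL
  have hLm : ∀ k, Measurable (L k) := fun k => measurable_levelFn hf k _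
  have hsum' : ∑' k, cakeNorm a leb (L k) ≤ C * mixMin a h := by
    refine le_trans (le_of_eq (tsum_congr fun k => ?_)) (hsum.trans (by gcongr))
    exact (cakeNorm_congr_ae (sum_Vpow_ae hff k fun α => ξ (List.ofFn α))).symm
  set R : ℕ → ℝ → ℝ := fun K t => x t - ∑ k ∈ Finset.range K, L k t with hR
  have hRm : ∀ K, Measurable (R K) := fun K =>
    hxm.sub (Finset.measurable_fun_sum _ fun k _ => hLm k)
  have hRlim : Tendsto (fun K => cakeNorm a leb (R K)) atTop (𝓝 0) := by
    refine (hlim.comp tendsto_wordsBelow).congr fun K => cakeNorm_congr_ae ?_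
    filter_upwards [ae_all_iff.2 fun k => sum_Vpow_ae hff k fun α => ξ (List.ofFn α)] with t ht
    rw [hR, sum_lists_eq (L := K) (fun α hα => mem_wordsBelow.1 hα) fun α => ξ α * Vpow α f₀ t]
    congr 1
    refine Finset.sum_congr rfl fun k hk => ?_
    refine Eq.trans ?_ (ht k)
    refine Finset.sum_congr rfl fun α _ => if_pos ?_
    rw [mem_wordsBelow, List.length_ofFn]
    exact Finset.mem_range.1 hk
  -- Convergence in norm implies convergence in `L¹`, so the remainder disappears from the
  -- integrated identity.
  have hE : Tendsto (fun K => ∫⁻ t, ‖R K t‖ₑ ∂leb) atTop (𝓝 0) := by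
    have h2 := ENNReal.Tendsto.const_mul (a := (mixMin a 1)⁻¹) hRlim
      (Or.inr (ENNReal.inv_ne_top.2 h0))
    rw [mul_zero] at h2
    refine tendsto_of_tendsto_of_tendsto_of_le_of_le tendsto_const_nhds h2 (fun _ => zero_le)
      fun K => ?_
    have h3 := mixMin_one_mul_lintegral_le (ν := leb) ha (hRm K).aemeasurable
    calc ∫⁻ t, ‖R K t‖ₑ ∂leb = (mixMin a 1)⁻¹ * (mixMin a 1 * ∫⁻ t, ‖R K t‖ₑ ∂leb) := by
          rw [← mul_assoc, ENNReal.inv_mul_cancel h0 h1, one_mul]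
      _ ≤ _ := by gcongr
  have key : ∀ K, ψ * h ≤ ψ * (∫⁻ t, ‖R K t‖ₑ ∂leb) + F * h * (C * mixMin a h) := by
    intro K
    have e1 : h ≤ (∫⁻ t, ‖R K t‖ₑ ∂leb) +
        ∑ k ∈ Finset.range K, ∫⁻ t in A, ‖L k t‖ₑ ∂leb := by
      calc h = ∫⁻ t in A, 1 ∂leb := by rw [setLIntegral_one, hA, leb_lastInterval]
        _ ≤ ∫⁻ t in A, (‖R K t‖ₑ + ∑ k ∈ Finset.range K, ‖L k t‖ₑ) ∂leb := by
            refine setLIntegral_mono' hAm fun t ht => ?_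
            have e : (1 : ℝ) = R K t + ∑ k ∈ Finset.range K, L k t := by
              simp [hR, hx, indicator_of_mem ht]
            have e' : (1 : ℝ≥0∞) = ‖(1 : ℝ)‖ₑ := by simp
            rw [e', e]
            exact (enorm_add_le _ _).trans (by gcongr; exact enorm_sum_le _ _)
        _ = (∫⁻ t in A, ‖R K t‖ₑ ∂leb) + ∑ k ∈ Finset.range K, ∫⁻ t in A, ‖L k t‖ₑ ∂leb := by
            rw [lintegral_add_left (hRm K).enorm, lintegral_finsetSum _ fun k _ => (hLm k).enorm]
        _ ≤ _ := add_le_add_left (setLIntegral_le_lintegral _ _) _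
    calc ψ * h ≤ ψ * ((∫⁻ t, ‖R K t‖ₑ ∂leb) +
          ∑ k ∈ Finset.range K, ∫⁻ t in A, ‖L k t‖ₑ ∂leb) := by gcongr
      _ = ψ * (∫⁻ t, ‖R K t‖ₑ ∂leb) +
          ∑ k ∈ Finset.range K, ψ * ∫⁻ t in A, ‖L k t‖ₑ ∂leb := by
          rw [mul_add, Finset.mul_sum]
      _ ≤ ψ * (∫⁻ t, ‖R K t‖ₑ ∂leb) +
          ∑ k ∈ Finset.range K, F * h * cakeNorm a leb (L k) := by
          exact add_le_add_right (Finset.sum_le_sum fun k _ =>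
            cakeNorm_mul_setLIntegral_levelFn_le ha hf hdecr n k _) _
      _ ≤ ψ * (∫⁻ t, ‖R K t‖ₑ ∂leb) + F * h * (C * mixMin a h) := by
          rw [← Finset.mul_sum]
          gcongr
          exact (ENNReal.sum_le_tsum _).trans hsum'
  have hfinal : ψ * h ≤ F * h * (C * mixMin a h) := by
    have h2 := (ENNReal.Tendsto.const_mul (a := ψ) hE (Or.inr hψfin)).add_const
      (F * h * (C * mixMin a h))
    rw [mul_zero, zero_add] at h2
    exact ge_of_tendsto h2 (Eventually.of_forall key)
  rw [show F * h * (C * mixMin a h) = F * C * mixMin a h * h by ring] at hfinal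
  exact (ENNReal.mul_le_mul_iff_left hh0 hht).1 hfinal

end Necessity

/-! ### From dyadic indicators to the multiplicator bound -/

section Multiplicator

variable {a : ℝ → ℝ≥0∞} {f : ℝ → ℝ}

/-- Round `w` up to the next power of two: the left side grows, and the right side changes by at
most a factor `2` by doubling. -/
theorem cakeNorm_smul_le_of_dyadic (ha : Measurable a) {D : ℝ≥0∞}
    (hD : ∀ n : ℕ, cakeNorm a ((2 ^ n : ℝ≥0∞)⁻¹ • leb) f ≤ D * mixMin a (2 ^ n)⁻¹) {w : ℝ≥0∞}
    (hw : w ≤ 1) : cakeNorm a (w • leb) f ≤ 2 * D * mixMin a w := by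
  rcases eq_or_ne w 0 with rfl | hw0
  · simp [cakeNorm, distr, mixMin_zero]
  have hwt : w ≠ ∞ := ne_top_of_le_ne_top ENNReal.one_ne_top hw
  obtain ⟨n, hn1, hn2⟩ := exists_nat_pow_near_of_lt_one (ENNReal.toReal_pos hw0 hwt)
    (ENNReal.toReal_le_of_le_ofReal zero_le_one (by simpa using hw))
    (by norm_num : (0 : ℝ) < 1 / 2) (by norm_num)
  have hpow : ∀ m : ℕ, (2 ^ m : ℝ≥0∞)⁻¹ = ENNReal.ofReal ((1 / 2) ^ m) := fun m => by
    rw [ENNReal.ofReal_pow (by norm_num), one_div, ENNReal.ofReal_inv_of_pos two_pos,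
      ENNReal.ofReal_ofNat, ENNReal.inv_pow]
  have h1 : (2 ^ (n + 1) : ℝ≥0∞)⁻¹ ≤ w := by
    rw [hpow]
    exact ENNReal.ofReal_le_of_le_toReal hn1.le
  have h2 : w ≤ (2 ^ n : ℝ≥0∞)⁻¹ := by
    rw [hpow]
    exact (ENNReal.le_ofReal_iff_toReal_le hwt (by positivity)).2 hn2
  have h3 : (2 ^ n : ℝ≥0∞)⁻¹ = 2 * (2 ^ (n + 1))⁻¹ := by
    rw [pow_succ', ENNReal.mul_inv (Or.inl two_ne_zero) (Or.inl ENNReal.ofNat_ne_top), ← mul_assoc,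
      ENNReal.mul_inv_cancel two_ne_zero ENNReal.ofNat_ne_top, one_mul]
  calc cakeNorm a (w • leb) f ≤ cakeNorm a ((2 ^ n : ℝ≥0∞)⁻¹ • leb) f := cakeNorm_smul_mono h2
    _ ≤ D * mixMin a (2 ^ n)⁻¹ := hD n
    _ ≤ D * (2 * mixMin a (2 ^ (n + 1))⁻¹) := by
        rw [h3]
        gcongr
        exact mixMin_mul_le ha one_le_two _
    _ ≤ D * (2 * mixMin a w) := by
        gcongr
        exact mixMin_mono h1
    _ = 2 * D * mixMin a w := by ring

theorem cakeNorm_tensor_indicator (hf : Measurable f) {A : Set ℝ} (hA : MeasurableSet A) :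
    cakeNorm a (leb.prod leb) (tensor f (A.indicator 1)) = cakeNorm a (leb A • leb) f := by
  refine setLIntegral_congr_fun measurableSet_Ioi fun s hs => congrArg (mixMin a) ?_
  rw [distr_tensor hf (measurable_one.indicator hA), distr_smul]
  have : ∀ t, distr leb (fun u => A.indicator 1 t * f u) s =
      A.indicator (fun _ => distr leb f s) t := fun t => by
    by_cases ht : t ∈ A
    · simp [ht]
    · simp [ht, distr]
  simp_rw [this]
  rw [lintegral_indicator_const hA, mul_comm]

/-- The `j`-th term is at most twice the integral over `(2^j ε / 2, 2^j ε]`, and these intervals are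
disjoint. -/
theorem sum_dyadic_le_lintegral {G : ℝ → ℝ≥0∞} (hG : Antitone G) {ε : ℝ} (hε : 0 < ε) (J : ℕ) :
    ∑ j ∈ Finset.range J, ENNReal.ofReal (2 ^ j * ε) * G (2 ^ j * ε) ≤
      2 * ∫⁻ s in Ioi (0 : ℝ), G s := by
  have key : ∑ j ∈ Finset.range J, ENNReal.ofReal (2 ^ j * ε) * G (2 ^ j * ε) ≤
      2 * ∫⁻ s in Ioc 0 (2 ^ J * ε / 2), G s := by
    induction J with
    | zero => simp
    | succ J ih =>
      have hp : 0 < 2 ^ J * ε := by positivity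
      have hun : Ioc 0 (2 ^ (J + 1) * ε / 2) =
          Ioc 0 (2 ^ J * ε / 2) ∪ Ioc (2 ^ J * ε / 2) (2 ^ J * ε) := by
        rw [Ioc_union_Ioc_eq_Ioc (by positivity) (by linarith), pow_succ]
        congr 1; ring
      have hdisj : Disjoint (Ioc 0 (2 ^ J * ε / 2)) (Ioc (2 ^ J * ε / 2) (2 ^ J * ε)) := by
        rw [Set.disjoint_left]
        exact fun s h h' => absurd h.2 (not_le.2 h'.1)
      rw [Finset.sum_range_succ, hun, lintegral_union measurableSet_Ioc hdisj, mul_add]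
      refine add_le_add ih ?_
      calc ENNReal.ofReal (2 ^ J * ε) * G (2 ^ J * ε)
          = 2 * ∫⁻ s in Ioc (2 ^ J * ε / 2) (2 ^ J * ε), G (2 ^ J * ε) := by
            rw [setLIntegral_const, Real.volume_Ioc, mul_comm (G _), ← mul_assoc]
            congr 1
            rw [← ENNReal.ofReal_ofNat 2, ← ENNReal.ofReal_mul zero_le_two]
            congr 1; ring
        _ ≤ _ := by
            exact mul_le_mul_right (setLIntegral_mono' measurableSet_Ioc fun s hs => hG hs.2) _
  refine key.trans ?_
  gcongr
  exact Ioc_subset_Ioi_self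

/-- The last active index `j` already gives `2^(j+1) ε ≥ v`. -/
theorem le_sum_dyadic {ε v : ℝ} (hε : 0 < ε) (hv : ε < v) (J : ℕ) (hJ : v ≤ 2 ^ J * ε) :
    v ≤ ∑ j ∈ Finset.range J, if 2 ^ j * ε < v then 2 ^ (j + 1) * ε else 0 := by
  induction J with
  | zero => simp at hJ; linarith
  | succ J ih =>
    rw [Finset.sum_range_succ]
    have hnn : ∀ j : ℕ, (0 : ℝ) ≤ if 2 ^ j * ε < v then 2 ^ (j + 1) * ε else 0 := fun j => by
      split_ifs <;> positivity
    by_cases h : 2 ^ J * ε < v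
    · rw [if_pos h]
      have := Finset.sum_nonneg fun j (_ : j ∈ Finset.range J) => hnn j
      linarith
    · have := ih (not_lt.1 h)
      linarith [hnn J]

/-- A Fatou property, by continuity from below of the measure and of `mixMin`. -/
theorem cakeNorm_le_of_monotone {Ω : Type*} [MeasurableSpace Ω] {ν : Measure Ω} (ha : Measurable a)
    {z : Ω → ℝ} {y : ℕ → Ω → ℝ} (hmono : ∀ u, Monotone fun n => ‖y n u‖ₑ)
    (hz : ∀ u, ∃ n, ‖z u‖ₑ ≤ ‖y n u‖ₑ) {D : ℝ≥0∞} (hD : ∀ n, cakeNorm a ν (y n) ≤ D) :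
    cakeNorm a ν z ≤ D := by
  have hdm : ∀ s, Monotone fun n => distr ν (y n) s := fun s m n hmn =>
    measure_mono fun u (hu : _ < _) => hu.trans_le (hmono u hmn)
  have hd : ∀ s, distr ν z s ≤ ⨆ n, distr ν (y n) s := by
    intro s
    have hun : {u | ENNReal.ofReal s < ‖z u‖ₑ} ⊆ ⋃ n, {u | ENNReal.ofReal s < ‖y n u‖ₑ} := by
      intro u hu
      obtain ⟨n, hn⟩ := hz u
      exact mem_iUnion.2 ⟨n, lt_of_lt_of_le (mem_ofPred.1 hu) hn⟩
    refine (measure_mono hun).trans (le_of_eq ?_)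
    exact Monotone.measure_iUnion fun m n hmn u (hu : _ < _) => hu.trans_le (hmono u hmn)
  calc cakeNorm a ν z ≤ ∫⁻ s in Ioi (0 : ℝ), ⨆ n, mixMin a (distr ν (y n) s) := by
        refine lintegral_mono fun s => ?_
        rw [← mixMin_iSup ha (hdm s)]
        exact mixMin_mono (hd s)
    _ = ⨆ n, cakeNorm a ν (y n) :=
        lintegral_iSup (fun n => measurable_mixMin.comp measurable_distr)
          fun m n hmn s => mixMin_mono (hdm s hmn)
    _ ≤ D := iSup_le hD

/-- Dominate `|y|` by dyadic multiples of the indicators of `{|y| > 2^j ε}`, apply the bound for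
indicators to each layer, and add. One factor `2` comes from rounding values up, the other from
comparing the dyadic sum with the integral. -/
theorem cakeNorm_tensor_le (ha : Measurable a) (hf : Measurable f) {D : ℝ≥0∞}
    (hD : ∀ w ≤ 1, cakeNorm a (w • leb) f ≤ D * mixMin a w) {y : ℝ → ℝ} (hy : Measurable y) :
    cakeNorm a (leb.prod leb) (tensor f y) ≤ 4 * D * cakeNorm a leb y := by
  set E : ℕ → Set ℝ := fun n => {t | (2 ^ n : ℝ)⁻¹ < |y t| ∧ |y t| ≤ 2 ^ n} with hE
  have hEmono : Monotone E := by
    intro m n hmn t ht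
    have h2 : (2 : ℝ) ^ m ≤ 2 ^ n := pow_le_pow_right₀ one_le_two hmn
    exact ⟨(inv_anti₀ (by positivity) h2).trans_lt ht.1, ht.2.trans h2⟩
  refine cakeNorm_le_of_monotone (y := fun n => tensor f ((E n).indicator y)) ha ?_ ?_ ?_
  · intro p m n hmn
    simp only [tensor, enorm_mul]
    refine mul_le_mul_right ?_ _
    by_cases h : p.2 ∈ E m
    · rw [indicator_of_mem h, indicator_of_mem (hEmono hmn h)]
    · rw [indicator_of_notMem h]; simp
  · intro p
    by_cases h : y p.2 = 0
    · exact ⟨0, by simp [tensor, h]⟩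
    have hpos : 0 < |y p.2| := abs_pos.2 h
    obtain ⟨n, hn⟩ := pow_unbounded_of_one_lt (max |y p.2| |y p.2|⁻¹) one_lt_two
    refine ⟨n, ?_⟩
    have hmem : p.2 ∈ E n :=
      ⟨inv_lt_of_inv_lt₀ hpos ((le_max_right _ _).trans_lt hn), ((le_max_left _ _).trans_lt hn).le⟩
    simp only [tensor, indicator_of_mem hmem, le_refl]
  · intro n
    -- On `E n` the values of `|y|` lie between `2⁻ⁿ` and `2ⁿ`, so `2 n` layers starting at `ε =
    -- 2⁻ⁿ` suffice.
    set ε : ℝ := (2 ^ n : ℝ)⁻¹ with hε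
    have hε0 : 0 < ε := by positivity
    set A : ℕ → Set ℝ := fun j => {t | 2 ^ j * ε < |y t|} with hA
    have hAm : ∀ j, MeasurableSet (A j) := fun j => measurableSet_lt measurable_const hy.abs
    have hAd : ∀ j, leb (A j) = distr leb y (2 ^ j * ε) := fun j => by
      refine congrArg leb ?_
      ext t
      simp only [hA, mem_ofPred_eq, ofReal_lt_enorm (show 0 ≤ 2 ^ j * ε by positivity)]
    have hpt : ∀ p : ℝ × ℝ, ‖tensor f ((E n).indicator y) p‖ₑ ≤
        ‖∑ j ∈ Finset.range (2 * n), 2 ^ (j + 1) * ε * tensor f ((A j).indicator 1) p‖ₑ := by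
      intro p
      have e : ∑ j ∈ Finset.range (2 * n), 2 ^ (j + 1) * ε * tensor f ((A j).indicator 1) p =
          f p.1 * ∑ j ∈ Finset.range (2 * n), if 2 ^ j * ε < |y p.2| then 2 ^ (j + 1) * ε else 0 := by
        rw [Finset.mul_sum]
        refine Finset.sum_congr rfl fun j _ => ?_
        by_cases h : 2 ^ j * ε < |y p.2|
        · rw [if_pos h, tensor, indicator_of_mem (show p.2 ∈ A j from h), Pi.one_apply]; ring
        · rw [if_neg h, tensor, indicator_of_notMem (show p.2 ∉ A j from h)]; ring
      rw [e, tensor, enorm_mul, enorm_mul]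
      refine mul_le_mul_right ?_ _
      by_cases h : p.2 ∈ E n
      · rw [indicator_of_mem h, Real.enorm_eq_ofReal_abs, Real.enorm_eq_ofReal_abs]
        refine ENNReal.ofReal_le_ofReal ((le_sum_dyadic hε0 h.1 (2 * n) ?_).trans (le_abs_self _))
        refine h.2.trans (le_of_eq ?_)
        rw [hε, two_mul, pow_add, mul_assoc, mul_inv_cancel₀ (by positivity), mul_one]
      · rw [indicator_of_notMem h]; simp
    have hm : ∀ j, Measurable (tensor f ((A j).indicator 1)) := fun j =>
      (hf.comp measurable_fst).mul ((measurable_one.indicator (hAm j)).comp measurable_snd)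
    calc cakeNorm a (leb.prod leb) (tensor f ((E n).indicator y))
        ≤ cakeNorm a (leb.prod leb) (fun p => ∑ j ∈ Finset.range (2 * n),
            2 ^ (j + 1) * ε * tensor f ((A j).indicator 1) p) :=
          cakeNorm_mono_ae (Eventually.of_forall hpt)
      _ ≤ ∑ j ∈ Finset.range (2 * n), cakeNorm a (leb.prod leb)
            (fun p => 2 ^ (j + 1) * ε * tensor f ((A j).indicator 1) p) :=
          cakeNorm_sum_le ha _ _ fun j => ((hm j).const_mul _).aemeasurable
      _ ≤ ∑ j ∈ Finset.range (2 * n), 2 * D *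
            (ENNReal.ofReal (2 ^ j * ε) * mixMin a (distr leb y (2 ^ j * ε))) := by
          refine Finset.sum_le_sum fun j _ => ?_
          rw [cakeNorm_const_mul, cakeNorm_tensor_indicator hf (hAm j),
            Real.enorm_of_nonneg (by positivity), pow_succ', mul_assoc 2,
            ENNReal.ofReal_mul zero_le_two, ENNReal.ofReal_ofNat]
          calc 2 * ENNReal.ofReal (2 ^ j * ε) * cakeNorm a (leb (A j) • leb) f
              ≤ 2 * ENNReal.ofReal (2 ^ j * ε) * (D * mixMin a (leb (A j))) := by
                gcongr
                exact hD _ prob_le_one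
            _ = _ := by rw [hAd]; ring
      _ ≤ 2 * D * (2 * cakeNorm a leb y) := by
          rw [← Finset.mul_sum]
          gcongr
          exact sum_dyadic_le_lintegral (G := fun s => mixMin a (distr leb y s))
            (fun s t h => mixMin_mono (distr_antitone h)) hε0 _
      _ = 4 * D * cakeNorm a leb y := by ring

theorem tensor_congr_ae {f g x y : ℝ → ℝ} (hfg : f =ᵐ[leb] g) (hxy : x =ᵐ[leb] y) :
    tensor f x =ᵐ[leb.prod leb] tensor g y := by
  filter_upwards [Measure.quasiMeasurePreserving_fst.ae hfg,
    Measure.quasiMeasurePreserving_snd.ae hxy] with p h1 h2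
  rw [tensor, tensor, h1, h2]

end Multiplicator

end LorentzDyadic

end

/-! ### The equivalence -/

open LorentzDyadic in
theorem theoremc1 (φ : ℝ → ℝ) (hmono : MonotoneOn φ (Icc 0 1)) (hconc : ConcaveOn ℝ (Icc 0 1) φ)
    (hzero : φ 0 = 0) (hpos : 0 < φ 1) (hlim : Tendsto φ (𝓝[>] 0) (𝓝 0))
    (f : ℝ → ℝ) (hf : LorentzDyadic.MemLorentz φ hmono LorentzDyadic.leb f)
    (hf0 : ¬ f =ᵐ[LorentzDyadic.leb] 0)
    (hfdecr : ∀ᵐ t ∂LorentzDyadic.leb,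
      f t = (LorentzDyadic.rearrangement LorentzDyadic.leb f t).toReal) :
    LorentzDyadic.IsAbsRepresenting φ hmono f ↔ LorentzDyadic.MemMultiplicator φ hmono f := by
  have hcont := continuousOn_of_concave hmono hconc hzero hlim
  set a := slopeDistr φ
  have ha : Measurable a := slopeDistr_antitone.measurable
  have hmix : mixMin a 1 = ENNReal.ofReal (φ 1) := by
    rw [ofReal_eq_mixMin hmono hconc hcont hzero (by simp : (1 : ℝ) ∈ Icc (0 : ℝ) 1),
      ENNReal.ofReal_one]
  have h0 : mixMin a 1 ≠ 0 := by rw [hmix]; exact (ENNReal.ofReal_pos.2 hpos).ne'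
  have h1 : mixMin a 1 ≠ ∞ := by rw [hmix]; exact ENNReal.ofReal_ne_top
  have hN : ∀ x : ℝ → ℝ, lorentzNorm φ hmono leb x = cakeNorm a leb x := fun x =>
    lorentzNorm_eq_cakeNorm hmono hconc hcont hzero
  have hN2 : ∀ x : ℝ × ℝ → ℝ, lorentzNorm φ hmono (leb.prod leb) x = cakeNorm a (leb.prod leb) x :=
    fun x => lorentzNorm_eq_cakeNorm hmono hconc hcont hzero
  obtain ⟨hfm, hffin⟩ := hf
  rw [hN] at hffin
  set g := hfm.mk f with hg
  have hfg : f =ᵐ[leb] g := hfm.ae_eq_mk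
  have hgm : Measurable g := hfm.stronglyMeasurable_mk.measurable
  have hgfin : cakeNorm a leb g ≠ ∞ := by rw [← cakeNorm_congr_ae hfg]; exact hffin.ne
  have hgint : Integrable g leb := integrable_of_cakeNorm ha h0 hgm.aemeasurable hgfin
  have hgdecr : ∀ᵐ t ∂leb, g t = (rearrangement leb g t).toReal := by
    have e : rearrangement leb f = rearrangement leb g := by
      ext t
      have : ∀ s : ℝ≥0∞, leb {u | s < ‖f u‖ₑ} = leb {u | s < ‖g u‖ₑ} := fun s =>
        measure_congr (hfg.mono fun u hu => by
          change (s < ‖f u‖ₑ) = (s < ‖g u‖ₑ)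
          rw [hu])
      simp only [rearrangement, this]
    filter_upwards [hfg, hfdecr] with t ht1 ht2
    rw [← ht1, ht2, e]
  -- Equality with the rearrangement makes `g` nonnegative, so a zero integral would force `f = 0`
  -- almost everywhere.
  have hgI : ∫ u, g u ∂leb ≠ 0 := by
    intro h
    rw [integral_eq_zero_iff_of_nonneg_ae (hgdecr.mono fun t ht => by
      rw [ht]; exact ENNReal.toReal_nonneg) hgint] at h
    exact hf0 (hfg.trans h)
  constructor
  · rintro ⟨C, -, hC⟩
    set F := ∫⁻ u, ‖g u‖ₑ ∂leb with hF
    have hFfin : F ≠ ∞ := hgint.2.ne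
    have hdy : ∀ n : ℕ, cakeNorm a ((2 ^ n : ℝ≥0∞)⁻¹ • leb) g ≤
        F * C * mixMin a (2 ^ n)⁻¹ := fun n => by
      refine cakeNorm_dyadic_le_of_representing ha h0 hfg h1 hgm hgfin hgdecr n fun x hx hxfin => ?_
      obtain ⟨ξ, hξ1, hξ2⟩ := hC x ⟨hx, by rw [hN]; exact hxfin.lt_top⟩
      simp only [hN] at hξ1 hξ2
      exact ⟨ξ, hξ1, hξ2⟩
    have hten : ∀ y : ℝ → ℝ, AEStronglyMeasurable y leb →
        cakeNorm a (leb.prod leb) (tensor f y) ≤ 4 * (2 * (F * C)) * cakeNorm a leb y := by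
      intro y hy
      rw [cakeNorm_congr_ae (tensor_congr_ae hfg hy.ae_eq_mk), cakeNorm_congr_ae hy.ae_eq_mk]
      exact cakeNorm_tensor_le ha hgm (fun w hw => cakeNorm_smul_le_of_dyadic ha hdy hw)
        hy.stronglyMeasurable_mk.measurable
    have hDfin : 4 * (2 * (F * C)) ≠ ∞ := by finiteness
    refine ⟨hfm, (4 * (2 * (F * C))).toNNReal, fun y hy => ?_⟩
    obtain ⟨hym, hyfin⟩ := hy
    have h2 := hten y hym
    rw [hN] at hyfin
    refine ⟨⟨?_, ?_⟩, ?_⟩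
    · exact (hfm.comp_fst (ν := leb)).mul (hym.comp_snd (μ := leb))
    · rw [hN2]
      exact h2.trans_lt (ENNReal.mul_lt_top hDfin.lt_top hyfin)
    · rw [hN2, hN, ENNReal.coe_toNNReal hDfin]
      exact h2
  · rintro ⟨-, M, hM⟩
    have hlev : ∀ (k : ℕ) (c : (Fin k → Bool) → ℝ),
        cakeNorm a leb (levelFn k c g) ≤ M * cakeNorm a leb fun t => c (digits k t) := by
      intro k c
      obtain ⟨B, hB⟩ := exists_bound_of_finite c
      have hcm := measurable_comp_digits c
      have hcfin : cakeNorm a leb (fun t => c (digits k t)) < ∞ :=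
        (cakeNorm_le_bound_mul (Eventually.of_forall fun t => enorm_le_coe_iff_abs.2 (hB _))).trans_lt
          (ENNReal.mul_lt_top ENNReal.coe_lt_top h1.lt_top)
      have h2 := (hM _ ⟨hcm.aestronglyMeasurable, by rwa [hN]⟩).2
      rw [hN2, hN, cakeNorm_congr_ae (tensor_congr_ae hfg (EventuallyEq.refl _ _))] at h2
      rwa [cakeNorm_levelFn hgm]
    set D : ℝ≥0∞ := 2 * (2 * M * ‖(∫ u, g u ∂leb)⁻¹‖ₑ) with hD
    have hDfin : D ≠ ∞ := by finiteness
    -- The added `1` only makes the constant strictly positive.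
    refine ⟨D.toNNReal + 1, by positivity, fun x hx => ?_⟩
    obtain ⟨hxm, hxfin⟩ := hx
    rw [hN] at hxfin
    obtain ⟨ξ, hξ1, hξ2⟩ := exists_representation ha h0 h1 hfg hgm hgfin hgI ENNReal.coe_ne_top hlev
      hxm.aemeasurable hxfin.ne
    simp only [hN]
    refine ⟨ξ, hξ1, hξ2.trans ?_⟩
    rw [ENNReal.coe_add, ENNReal.coe_toNNReal hDfin, add_mul]
    exact le_self_add
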